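/- Let $\mathcal H$ be a complex Hilbert space. For bounded operators on $\mathcal H$ let $\le$ be the Loewner order, and write $A>0$ if $A$ is positive and invertible. For self-adjoint $X$, $f(X)$ is the continuous functional calculus, $\|X\|_\infty$ is the operator norm, and $\lambda_{\min}(X)$ is the minimum of the spectrum of $X$. A continuous function $f:(0,\infty)\to\mathbb R$ is *operator convex* if $f(rA+(1-r)B)\le rf(A)+(1-r)f(B)$ for all $A,B>0$ on any Hilbert space and all $r\in[0,1]$. A continuous function $g:(0,\infty)\to\mathbb R$ is *operator monotone decreasing* if $0<A\le B$ implies $g(A)\ge g(B)$ for all such $A,B$ on any Hilbert space. Let $\mathrm{OC}_+^1$ (resp. $\mathrm{OMD}_+^1$) be the set of operator convex (resp. operator monotone decreasing) functions $f$ on $(0,\infty)$ with $f>0$ and $f(1)=1$. The operator perspective of $f$ is $$P_f(A,B):=B^{1/2}f(B^{-1/2}AB^{-1/2})B^{1/2},\qquad A,B>0.$$ The generalized Kantorovich constant is $$K(\xi,p):=\frac{\xi^p-\xi}{(p-1)(\xi-1)}\left(\frac{p-1}{p}\cdot\frac{\xi^p-1}{\xi^p-\xi}\right)^p\qquad(\xi>1,\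 p\neq1),$$ with $K(\xi,1):=1$ and $K(1,p):=1$ (the limiting values). **Proposition.** Let $f\in\mathrm{OC}_+^1$ with $f(0^+):=\lim_{t\to0^+}f(t)=0$, and let $A,B>0$. Set $C:=A^{1/2}B^{-1}A^{1/2}$ and $\xi:=\|A\|_\infty/\lambda_{\min}(A)$. Then for every $p\in[1,2]$, $$P_f(A,B)\le I\ \Longrightarrow\ P_f(A^p,B^p)\le K(\xi,2p-1)\left\|\frac{f(C^p)}{f(C)^p}\right\|_\infty\lambda_{\min}(P_f(A,B))^{1-p}\,I,$$ $$P_f(A,B)\ge I\ \Longrightarrow\ P_f(A^p,B^p)\ge K(\xi,2p-1)^{-1}\,\lambda_{\min}\!\left(\frac{f(C^p)}{f(C)^p}\right)\|P_f(A,B)\|_\infty^{1-p}\,I.$$ The same two implications hold for every $g\in\mathrm{OMD}_+^1$ in place of $f$ (with the same $C$), when $\xi:=\|B\|_\infty/\lambda_{\min}(B)$. -/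

import Mathlib

open Filter Topology

universe u

/-- `f` is operator monotone on `(0, ∞)`: it is continuous there, and `0 < A ≤ B` implies
`f(A) ≤ f(B)` for bounded operators on any complex Hilbert space.  Here `A > 0` means that `A`
is positive and invertible, `≤` is the Loewner order, and `f(A)` is the continuous
functional calculus. -/
def IsOperatorMonotone (f : ℝ → ℝ) : Prop :=
  ContinuousOn f (Set.Ioi 0) ∧
    ∀ (K : Type u) [NormedAddCommGroup K] [InnerProductSpace ℂ K] [CompleteSpace K]
      (A B : K →L[ℂ] K), IsStrictlyPositive A → A ≤ B → cfc f A ≤ cfc f B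

/-- `f` is operator monotone decreasing on `(0, ∞)`: `-f` is operator monotone. -/
def IsOperatorMonotoneDecreasing (f : ℝ → ℝ) : Prop :=
  IsOperatorMonotone.{u} (fun t => -f t)

/-- `f` is operator convex on `(0, ∞)`: it is continuous there, and
`f(rA + (1-r)B) ≤ r f(A) + (1-r) f(B)` for all `A, B > 0` on any complex Hilbert space and
all `r ∈ [0,1]`. -/
def IsOperatorConvex (f : ℝ → ℝ) : Prop :=
  ContinuousOn f (Set.Ioi 0) ∧
    ∀ (K : Type u) [NormedAddCommGroup K] [InnerProductSpace ℂ K] [CompleteSpace K]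
      (A B : K →L[ℂ] K), IsStrictlyPositive A → IsStrictlyPositive B →
      ∀ r : ℝ, r ∈ Set.Icc (0 : ℝ) 1 →
        cfc f (r • A + (1 - r) • B) ≤ r • cfc f A + (1 - r) • cfc f B

/-- The class `OC₊¹`: positive operator convex functions `f` on `(0, ∞)` with `f 1 = 1`. -/
def MemOCPlusOne (f : ℝ → ℝ) : Prop :=
  IsOperatorConvex.{u} f ∧ (∀ t : ℝ, 0 < t → 0 < f t) ∧ f 1 = 1

/-- The class `OMD₊¹`: positive operator monotone decreasing functions `g` on `(0, ∞)` with
`g 1 = 1`. -/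
def MemOMDPlusOne (g : ℝ → ℝ) : Prop :=
  IsOperatorMonotoneDecreasing.{u} g ∧ (∀ t : ℝ, 0 < t → 0 < g t) ∧ g 1 = 1

/-- The generalized Kantorovich constant `K(ξ, p)`, for `ξ ≥ 1`.  The values at `p = 1` and at
`ξ = 1`, where the formula reads `0 / 0`, are its limits, both equal to `1`. -/
noncomputable def kantorovichConst (ξ p : ℝ) : ℝ :=
  if p = 1 ∨ ξ = 1 then 1
  else (ξ ^ p - ξ) / ((p - 1) * (ξ - 1)) * ((p - 1) / p * ((ξ ^ p - 1) / (ξ ^ p - ξ))) ^ p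

section Operators

variable {H : Type u} [NormedAddCommGroup H] [InnerProductSpace ℂ H] [CompleteSpace H]

/-- The minimum of the spectrum of a self-adjoint operator. -/
noncomputable def lambdaMin (X : H →L[ℂ] H) : ℝ :=
  sInf (spectrum ℝ X)

/-- The operator perspective `P_f(A,B) = B^{1/2} f(B^{-1/2} A B^{-1/2}) B^{1/2}`. -/
noncomputable def operatorPerspective (f : ℝ → ℝ) (A B : H →L[ℂ] H) : H →L[ℂ] H :=
  B ^ (1 / 2 : ℝ) * cfc f (B ^ (-(1 / 2) : ℝ) * A * B ^ (-(1 / 2) : ℝ)) * B ^ (1 / 2 : ℝ)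

/-- The operator `C = A^{1/2} B⁻¹ A^{1/2}`. -/
noncomputable def relativeOperator (A B : H →L[ℂ] H) : H →L[ℂ] H :=
  A ^ (1 / 2 : ℝ) * B ^ (-1 : ℝ) * A ^ (1 / 2 : ℝ)

/-- The operator `f(C^p) / f(C)^p`, that is `f(C^p) (f(C))^{-p}` (the two factors commute). -/
noncomputable def powerRatio (f : ℝ → ℝ) (p : ℝ) (C : H →L[ℂ] H) : H →L[ℂ] H :=
  cfc f (C ^ p) * (cfc f C) ^ (-p)

/-- The condition number `‖A‖ / λ_min(A)` of a positive invertible operator. -/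
noncomputable def conditionNumber (A : H →L[ℂ] H) : ℝ :=
  ‖A‖ / lambdaMin A

end Operators

/-! ### Functional calculus and intertwining operators -/

section Intertwining

open ContinuousLinearMap

variable {H : Type*} [NormedAddCommGroup H] [InnerProductSpace ℂ H] [CompleteSpace H]
variable {K : Type*} [NormedAddCommGroup K] [InnerProductSpace ℂ K] [CompleteSpace K]

/-! Both perspectives have the form `A^{1/2} h(C) A^{1/2}` with `h` positive and operator monotone:
`h(t) = f(t)/t` in the convex case, where `f(0⁺) = 0` is essential, and `h(t) = g(1/t)` in the
decreasing case after `A` and `B` change places. Everything thus reduces to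
`IsOperatorMonotone.andoHiai_bounds`.

Suppose `σ ≤ A^{1/2} h(C) A^{1/2} ≤ 1`, that is `h(C) ≤ A⁻¹ ≤ k(C)` with `k = h/σ`. The operator
`C_p = A^{p/2} B^{-p} A^{p/2}` can be rewritten (`relativeOperator_rpow`) as `A^{(p-1)/2} C^{1/2}
(C^{1/2} A⁻¹ C^{1/2})^{p-1} C^{1/2} A^{(p-1)/2}`. As `0 ≤ p - 1 ≤ 1`, Löwner–Heinz gives `C_p ≤ T
C^p T*` and `T T* ≥ 1` for `T = A^{(p-1)/2} k(C)^{(p-1)/2}`. Monotonicity and the reverse Hansen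
inequality then yield `h(C_p) ≤ T h(C^p) T*`, and a bound `h(t^p) ≤ c h(t)^p` on the spectrum of `C`
makes this at most `c σ^{1-p} A^{(p-1)/2} h(C)^{2p-1} A^{(p-1)/2}`. The exponent `2p - 1` is out of
reach of Löwner–Heinz, so `h(C) ≤ A⁻¹` is raised to it at the cost of the Kantorovich constant,
after which all powers of `A` cancel. The lower bound reverses each step and uses Hansen's
inequality for a contraction.

The Hansen and Hansen–Pedersen inequalities are obtained by dilating a contraction to an isometry
and moving the functional calculus across intertwining relations. -/

lemma smul_one_le_iff_spectrum {a : H →L[ℂ] H} (ha : IsSelfAdjoint a) {r : ℝ} :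
    r • (1 : H →L[ℂ] H) ≤ a ↔ ∀ x ∈ spectrum ℝ a, r ≤ x := by
  rw [← Algebra.algebraMap_eq_smul_one]
  exact algebraMap_le_iff_le_spectrum

lemma le_smul_one_iff_spectrum {a : H →L[ℂ] H} (ha : IsSelfAdjoint a) {r : ℝ} :
    a ≤ r • (1 : H →L[ℂ] H) ↔ ∀ x ∈ spectrum ℝ a, x ≤ r := by
  rw [← Algebra.algebraMap_eq_smul_one]
  exact le_algebraMap_iff_spectrum_le

lemma isStrictlyPositive_smul_one {r : ℝ} (hr : 0 < r) :
    IsStrictlyPositive (r • (1 : H →L[ℂ] H)) :=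
  IsStrictlyPositive.smul hr isStrictlyPositive_one

lemma IsStrictlyPositive.spectrum_subset_Ioi {a : H →L[ℂ] H} (ha : IsStrictlyPositive a) :
    spectrum ℝ a ⊆ Set.Ioi 0 := fun _ hx => ha.spectrum_pos hx

lemma IsStrictlyPositive.exists_smul_one_le {a : H →L[ℂ] H} (ha : IsStrictlyPositive a) :
    ∃ r : ℝ, 0 < r ∧ r • (1 : H →L[ℂ] H) ≤ a := by
  rcases subsingleton_or_nontrivial (H →L[ℂ] H) with h | h
  · exact ⟨1, one_pos, (Subsingleton.elim _ _).le⟩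
  · obtain ⟨r, hr, hle⟩ := (CFC.exists_pos_algebraMap_le_iff ha.isSelfAdjoint).2
      fun x hx => ha.spectrum_pos hx
    exact ⟨r, hr, by rwa [← Algebra.algebraMap_eq_smul_one]⟩

lemma spectrum_subset_Icc {a : H →L[ℂ] H} {m M : ℝ} (ha : IsSelfAdjoint a)
    (hm : m • (1 : H →L[ℂ] H) ≤ a) (hM : ‖a‖ ≤ M) : spectrum ℝ a ⊆ Set.Icc m M := fun x hx =>
  ⟨(smul_one_le_iff_spectrum ha).1 hm x hx,
    (le_smul_one_iff_spectrum ha).1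
      (ha.le_algebraMap_norm_self.trans_eq (Algebra.algebraMap_eq_smul_one _)) x hx |>.trans hM⟩

set_option linter.unusedSectionVars false in
lemma aeval_comp_of_intertwine {a : H →L[ℂ] H} {b : K →L[ℂ] K} {T : H →L[ℂ] K}
    (h : b ∘L T = T ∘L a) (q : Polynomial ℝ) :
    Polynomial.aeval b q ∘L T = T ∘L Polynomial.aeval a q := by
  induction q using Polynomial.induction_on' with
  | add p q hp hq => simp [add_comp, comp_add, hp, hq]
  | monomial n c =>
    have hn : (b ^ n) ∘L T = T ∘L (a ^ n) := by
      induction n with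
      | zero => ext; simp
      | succ n ih =>
        rw [pow_succ, pow_succ, mul_def, mul_def, comp_assoc, h, ← comp_assoc, ih, comp_assoc]
    ext x
    have := congr($hn x)
    simp only [coe_comp, Function.comp_apply] at this
    simp [Polynomial.aeval_monomial, Algebra.algebraMap_eq_smul_one, this]

lemma norm_cfc_sub_aeval_le {c : H →L[ℂ] H} (hc : IsSelfAdjoint c) {s : Set ℝ}
    (hs : spectrum ℝ c ⊆ s) {f : ℝ → ℝ} (hf : ContinuousOn f s) {q : Polynomial ℝ} {ε : ℝ}
    (hε : 0 < ε) (hq : ∀ x ∈ s, |q.eval x - f x| < ε) :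
    ‖cfc f c - Polynomial.aeval c q‖ ≤ ε := by
  rw [← cfc_polynomial q c hc, ← cfc_sub f q.eval c (hf.mono hs) q.continuous.continuousOn]
  refine norm_cfc_le hε.le fun x hx => ?_
  rw [Real.norm_eq_abs, abs_sub_comm]
  exact (hq x (hs hx)).le

/-- The continuous functional calculus respects intertwining operators. -/
theorem cfc_comp_of_intertwine {a : H →L[ℂ] H} {b : K →L[ℂ] K} {T : H →L[ℂ] K}
    (ha : IsStrictlyPositive a) (hb : IsStrictlyPositive b) {f : ℝ → ℝ}
    (hf : ContinuousOn f (Set.Ioi 0)) (h : b ∘L T = T ∘L a) :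
    cfc f b ∘L T = T ∘L cfc f a := by
  obtain ⟨r, hr, hra⟩ := ha.exists_smul_one_le
  obtain ⟨s, hs, hsb⟩ := hb.exists_smul_one_le
  -- A single polynomial has to approximate `f` on both spectra, so both are placed in one compact
  -- interval inside `(0, ∞)`.
  set m := min r s
  set M := max ‖a‖ ‖b‖
  have hm : 0 < m := lt_min hr hs
  have hfI : ContinuousOn f (Set.Icc m M) := hf.mono fun x hx => hm.trans_le hx.1
  have hsa : spectrum ℝ a ⊆ Set.Icc m M := (spectrum_subset_Icc ha.isSelfAdjoint hra
    (le_max_left _ _)).trans (Set.Icc_subset_Icc_left (min_le_left _ _))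
  have hsb : spectrum ℝ b ⊆ Set.Icc m M := (spectrum_subset_Icc hb.isSelfAdjoint hsb
    (le_max_right _ _)).trans (Set.Icc_subset_Icc_left (min_le_right _ _))
  have bound : ∀ ε : ℝ, 0 < ε → ‖cfc f b ∘L T - T ∘L cfc f a‖ ≤ ε * (2 * ‖T‖) := by
    intro ε hε
    obtain ⟨q, hq⟩ := exists_polynomial_near_of_continuousOn m M f hfI ε hε
    have e : cfc f b ∘L T - T ∘L cfc f a = (cfc f b - Polynomial.aeval b q) ∘L T -
        T ∘L (cfc f a - Polynomial.aeval a q) := by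
      rw [sub_comp, comp_sub, aeval_comp_of_intertwine h]
      abel
    calc _ ≤ ‖cfc f b - Polynomial.aeval b q‖ * ‖T‖ + ‖T‖ * ‖cfc f a - Polynomial.aeval a q‖ := by
          rw [e]
          exact (norm_sub_le _ _).trans (add_le_add (opNorm_comp_le _ _) (opNorm_comp_le _ _))
      _ ≤ ε * ‖T‖ + ‖T‖ * ε := by
          gcongr
          · exact norm_cfc_sub_aeval_le hb.isSelfAdjoint hsb hfI hε hq
          · exact norm_cfc_sub_aeval_le ha.isSelfAdjoint hsa hfI hε hq
      _ = _ := by ring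
  rw [← sub_eq_zero, ← norm_le_zero_iff]
  have hlim : Tendsto (fun ε : ℝ => ε * (2 * ‖T‖)) (𝓝[>] 0) (𝓝 0) := by
    have : Tendsto (fun ε : ℝ => ε * (2 * ‖T‖)) (𝓝 0) (𝓝 (0 * (2 * ‖T‖))) :=
      tendsto_id.mul_const _
    rw [zero_mul] at this
    exact this.mono_left nhdsWithin_le_nhds
  exact ge_of_tendsto hlim (eventually_mem_nhdsWithin.mono fun ε hε => bound ε hε)

/-- Intertwining inside a single operator algebra. -/
theorem cfc_mul_of_intertwine {a b T : H →L[ℂ] H}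
    (ha : IsStrictlyPositive a) (hb : IsStrictlyPositive b) {f : ℝ → ℝ}
    (hf : ContinuousOn f (Set.Ioi 0)) (h : b * T = T * a) :
    cfc f b * T = T * cfc f a :=
  cfc_comp_of_intertwine ha hb hf h

lemma IsStrictlyPositive.cfc_of_pos {a : H →L[ℂ] H} (ha : IsStrictlyPositive a) {f : ℝ → ℝ}
    (hf : ContinuousOn f (Set.Ioi 0)) (hpos : ∀ t, 0 < t → 0 < f t) :
    IsStrictlyPositive (cfc f a) := by
  rw [cfc_isStrictlyPositive_iff f a (hf.mono ha.spectrum_subset_Ioi) ha.isSelfAdjoint]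
  exact fun x hx => hpos x (ha.spectrum_pos hx)

/-- The uniform lower bound `m > 0`, together with convergence of the norms, confines all spectra to
one compact subset of `(0, ∞)`; `f` need not be continuous at `0`. -/
lemma tendsto_cfc_of_smul_one_le {ι : Type*} {l : Filter ι} {a : ι → H →L[ℂ] H} {a₀ : H →L[ℂ] H}
    {m : ℝ} (hm : 0 < m) (ha : Tendsto a l (𝓝 a₀)) (hsa : ∀ᶠ i in l, IsSelfAdjoint (a i))
    (ha₀ : IsSelfAdjoint a₀)
    (hma : ∀ᶠ i in l, m • (1 : H →L[ℂ] H) ≤ a i) (hma₀ : m • (1 : H →L[ℂ] H) ≤ a₀)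
    {f : ℝ → ℝ} (hf : ContinuousOn f (Set.Ioi 0)) :
    Tendsto (fun i => cfc f (a i)) l (𝓝 (cfc f a₀)) := by
  have hM : ∀ᶠ i in l, ‖a i‖ ≤ ‖a₀‖ + 1 :=
    (ha.norm.eventually_lt_const (lt_add_one _)).mono fun i hi => hi.le
  refine Filter.Tendsto.cfc (s := Set.Icc m (‖a₀‖ + 1)) isCompact_Icc f ha ?_ hsa
    (spectrum_subset_Icc ha₀ hma₀ (lt_add_one _).le) ha₀
    (hf.mono fun x hx => hm.trans_le hx.1)
  filter_upwards [hM, hsa, hma] with i h1 h2 h3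
  exact spectrum_subset_Icc h2 h3 h1

lemma adjoint_conj_mono {a b : K →L[ℂ] K} (hab : a ≤ b) (T : H →L[ℂ] K) :
    adjoint T ∘L a ∘L T ≤ adjoint T ∘L b ∘L T := by
  rw [ContinuousLinearMap.le_def] at hab ⊢
  have := hab.adjoint_conj T
  simpa [comp_sub, sub_comp] using this

end Intertwining

/-! ### Jensen-type inequalities for compressions by an isometry -/

section Isometry

open ContinuousLinearMap

variable {H K : Type u} [NormedAddCommGroup H] [InnerProductSpace ℂ H] [CompleteSpace H]
variable [NormedAddCommGroup K] [InnerProductSpace ℂ K] [CompleteSpace K]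

lemma isStrictlyPositive_compression {V : H →L[ℂ] K} (hV : adjoint V ∘L V = 1) {Y : K →L[ℂ] K}
    (hY : IsStrictlyPositive Y) : IsStrictlyPositive (adjoint V ∘L Y ∘L V) := by
  obtain ⟨r, hr, hle⟩ := hY.exists_smul_one_le
  refine (isStrictlyPositive_smul_one hr).of_le ?_
  have h := adjoint_conj_mono hle V
  have e : adjoint V ∘L (r • (1 : K →L[ℂ] K)) ∘L V = r • (adjoint V ∘L V) := by
    ext x; simp
  rwa [e, hV] at h

/-- Jensen's operator inequality for an operator convex function and an isometry. -/
theorem IsOperatorConvex.cfc_compression_le {f : ℝ → ℝ} (hf : IsOperatorConvex.{u} f)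
    {V : H →L[ℂ] K} (hV : adjoint V ∘L V = 1) {Y : K →L[ℂ] K} (hY : IsStrictlyPositive Y) :
    cfc f (adjoint V ∘L Y ∘L V) ≤ adjoint V ∘L cfc f Y ∘L V := by
  -- The reflection fixing the range of `V`. Averaging `Y` with `W Y W` removes the off-diagonal
  -- blocks of `Y`, so the average maps the range of `V` to itself and intertwines with the
  -- compression.
  set W : K →L[ℂ] K := (2 : ℝ) • (V ∘L adjoint V) - 1 with hW
  have hVV : ∀ x, adjoint V (V x) = x := fun x => congr($hV x)
  have hWsa : star W = W := by
    rw [star_eq_adjoint, hW]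
    simp [← star_eq_adjoint]
    simp [star_eq_adjoint, adjoint_comp]
  have hWW : W * W = 1 := by
    ext x
    simp [hW, hVV]
    module
  have hWV : W ∘L V = V := by
    ext x
    simp [hW, hVV]
    module
  have hVW : adjoint V ∘L W = adjoint V := by
    have := congr(adjoint $hWV)
    rwa [adjoint_comp, ← star_eq_adjoint, hWsa] at this
  have hWu : IsUnit W := ⟨⟨W, W, hWW, hWW⟩, rfl⟩
  have hY' : IsStrictlyPositive (W * Y * W) :=
    IsStrictlyPositive.conjugate_of_isUnit_of_isSelfAdjoint Y W hWu hWsa hY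
  have hfW : cfc f (W * Y * W) = W * cfc f Y * W := by
    have := cfc_mul_of_intertwine (T := W) hY hY' hf.1 (by rw [mul_assoc, hWW, mul_one])
    rw [← this, mul_assoc (cfc f _) W W, hWW, mul_one]
  set Z : K →L[ℂ] K := (1 / 2 : ℝ) • Y + (1 - 1 / 2 : ℝ) • (W * Y * W) with hZ
  have hZs : IsStrictlyPositive Z :=
    (IsStrictlyPositive.smul (by norm_num) hY).add_nonneg (smul_nonneg (by norm_num) hY'.nonneg)
  have key := hf.2 K Y (W * Y * W) hY hY' (1 / 2) ⟨by norm_num, by norm_num⟩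
  have hWv : ∀ x, W (V x) = V x := fun x => congr($hWV x)
  have hvW : ∀ x, adjoint V (W x) = adjoint V x := fun x => congr($hVW x)
  have hZV : Z ∘L V = V ∘L (adjoint V ∘L Y ∘L V) := by
    ext x
    simp [hZ, hWv]
    simp [hW]
    module
  have hfZ := cfc_comp_of_intertwine (isStrictlyPositive_compression hV hY) hZs hf.1 hZV
  have h := adjoint_conj_mono key V
  rw [← hZ, hfZ, ← comp_assoc (adjoint V) V, hV, one_def, id_comp, hfW] at h
  refine h.trans_eq ?_
  ext x
  simp [hWv, hvW]

/-- Jensen's operator inequality for an operator monotone function and an isometry. -/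
theorem IsOperatorMonotone.compression_cfc_le {h : ℝ → ℝ} (hh : IsOperatorMonotone.{u} h)
    {V : H →L[ℂ] K} (hV : adjoint V ∘L V = 1) {Y : K →L[ℂ] K} (hY : IsStrictlyPositive Y)
    {ε : ℝ} (hε : 0 < ε) :
    adjoint V ∘L cfc h Y ∘L V ≤ cfc h ((1 + ε) • (adjoint V ∘L Y ∘L V)) := by
  have hVV : ∀ x, adjoint V (V x) = x := fun x => congr($hV x)
  set Q : K →L[ℂ] K := V ∘L adjoint V with hQ
  have hQsa : star Q = Q := by simp [star_eq_adjoint, hQ, adjoint_comp]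
  -- A block-diagonal majorant of `Y`: the off-diagonal blocks are absorbed by weights `ε` and
  -- `ε⁻¹`, since `Z - Y = S Y S*` for the `S` below.
  set Z : K →L[ℂ] K := (1 + ε) • (Q * Y * Q) + (1 + ε⁻¹) • ((1 - Q) * Y * (1 - Q)) with hZ
  set S : K →L[ℂ] K := ε.sqrt • Q - (ε.sqrt)⁻¹ • (1 - Q) with hS
  have hSsa : star S = S := by simp [hS, hQsa]
  have hs0 : ε.sqrt ≠ 0 := (Real.sqrt_pos.2 hε).ne'
  have hs2 : ε = ε.sqrt * ε.sqrt := (Real.mul_self_sqrt hε.le).symm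
  have hYZ : Y ≤ Z := by
    have h0 : 0 ≤ S * Y * star S := star_right_conjugate_nonneg hY.nonneg S
    rw [← sub_nonneg]
    refine h0.trans_eq ?_
    rw [hSsa]
    have hone : (ε.sqrt) * (ε.sqrt)⁻¹ = 1 := mul_inv_cancel₀ hs0
    have hinv : ε⁻¹ = (ε.sqrt)⁻¹ * (ε.sqrt)⁻¹ := by rw [← mul_inv, ← hs2]
    ext x
    simp only [hZ, hS, hinv]
    generalize ε.sqrt⁻¹ = t at *
    generalize ε.sqrt = s at *
    simp [mul_sub, sub_mul, smul_sub, smul_smul, mul_comm t s, hone, hs2]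
    module
  have hZs : IsStrictlyPositive Z := hY.of_le hYZ
  have hZV : Z ∘L V = V ∘L ((1 + ε) • (adjoint V ∘L Y ∘L V)) := by
    ext x
    simp [hZ, hQ, hVV]
  have hc : IsStrictlyPositive ((1 + ε) • (adjoint V ∘L Y ∘L V)) :=
    IsStrictlyPositive.smul (by linarith) (isStrictlyPositive_compression hV hY)
  have hfZ := cfc_comp_of_intertwine hc hZs hh.1 hZV
  have key := adjoint_conj_mono (hh.2 K Y Z hY hYZ) V
  rwa [hfZ, ← comp_assoc (adjoint V) V, hV, one_def, id_comp] at key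

end Isometry

/-! ### Hansen and Hansen–Pedersen inequalities by dilation -/

section Contraction

open ContinuousLinearMap

variable {H : Type u} [NormedAddCommGroup H] [InnerProductSpace ℂ H] [CompleteSpace H]

/-- Every Hilbert space `H` sits as two complementary orthogonal summands in a Hilbert space of
the same universe. -/
lemma exists_orthogonal_double (H : Type u) [NormedAddCommGroup H] [InnerProductSpace ℂ H]
    [CompleteSpace H] :
    ∃ (K : Type u) (_ : NormedAddCommGroup K) (_ : InnerProductSpace ℂ K) (_ : CompleteSpace K)
      (i j : H →L[ℂ] K), adjoint i ∘L i = 1 ∧ adjoint j ∘L j = 1 ∧ adjoint i ∘L j = 0 ∧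
        adjoint j ∘L i = 0 ∧ i ∘L adjoint i + j ∘L adjoint j = 1 := by
  let i : H →L[ℂ] WithLp 2 (H × H) :=
    ((WithLp.prodContinuousLinearEquiv 2 ℂ H H).symm : H × H →L[ℂ] WithLp 2 (H × H)) ∘L
      ContinuousLinearMap.inl ℂ H H
  let j : H →L[ℂ] WithLp 2 (H × H) :=
    ((WithLp.prodContinuousLinearEquiv 2 ℂ H H).symm : H × H →L[ℂ] WithLp 2 (H × H)) ∘L
      ContinuousLinearMap.inr ℂ H H
  have hi : adjoint i = WithLp.fstL 2 ℂ H H := by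
    symm
    rw [eq_adjoint_iff]
    intro x y
    simp [i, WithLp.prod_inner_apply]
  have hj : adjoint j = WithLp.sndL 2 ℂ H H := by
    symm
    rw [eq_adjoint_iff]
    intro x y
    simp [j, WithLp.prod_inner_apply]
  refine ⟨WithLp 2 (H × H), inferInstance, inferInstance, inferInstance, i, j, ?_, ?_, ?_, ?_, ?_⟩
  · rw [hi]; ext x; simp [i]
  · rw [hj]; ext x; simp [j]
  · rw [hi]; ext x; simp [j]
  · rw [hj]; ext x; simp [i]
  · rw [hi, hj]
    refine ContinuousLinearMap.ext fun x => WithLp.ofLp_injective 2 (Prod.ext ?_ ?_) <;> simp [i, j]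

/-- The defect operator `D = (1 - T T*)^{1/2}` supplies the second component of the isometric
dilation. -/
lemma exists_mul_self_add_eq_one {T : H →L[ℂ] H} (hT : T * star T ≤ 1) :
    ∃ D : H →L[ℂ] H, star D = D ∧ T * star T + D * D = 1 := by
  have h0 : (0 : H →L[ℂ] H) ≤ 1 - T * star T := sub_nonneg.2 hT
  refine ⟨CFC.sqrt (1 - T * star T), (CFC.sqrt_nonneg _).isSelfAdjoint, ?_⟩
  rw [CFC.sqrt_mul_sqrt_self _ h0]
  abel

lemma isStrictlyPositive_block_diagonal {K : Type u} [NormedAddCommGroup K]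
    [InnerProductSpace ℂ K] [CompleteSpace K] {i j : H →L[ℂ] K}
    (hsum : i ∘L adjoint i + j ∘L adjoint j = 1) {X : H →L[ℂ] H} (hX : IsStrictlyPositive X)
    {δ : ℝ} (hδ : 0 < δ) :
    IsStrictlyPositive (i ∘L X ∘L adjoint i + δ • (j ∘L adjoint j)) := by
  obtain ⟨r, hr, hle⟩ := hX.exists_smul_one_le
  refine (isStrictlyPositive_smul_one (lt_min hr hδ)).of_le ?_
  have h1 := adjoint_conj_mono hle (adjoint i)
  have h2 : (0 : K →L[ℂ] K) ≤ i ∘L adjoint i := by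
    rw [nonneg_iff_isPositive]; exact isPositive_self_comp_adjoint i
  have h3 : (0 : K →L[ℂ] K) ≤ j ∘L adjoint j := by
    rw [nonneg_iff_isPositive]; exact isPositive_self_comp_adjoint j
  calc min r δ • (1 : K →L[ℂ] K)
      = min r δ • (i ∘L adjoint i) + min r δ • (j ∘L adjoint j) := by rw [← hsum, smul_add]
    _ ≤ r • (i ∘L adjoint i) + δ • (j ∘L adjoint j) :=
        add_le_add (smul_le_smul_of_nonneg_right (min_le_left _ _) h2)
          (smul_le_smul_of_nonneg_right (min_le_right _ _) h3)
    _ ≤ _ := by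
        gcongr
        rw [adjoint_adjoint] at h1
        refine le_trans (le_of_eq ?_) h1
        ext x; simp

/-- A dilation: for a contraction `T` and positive `X`, `δ`, the pair `f(X), f(δ)` is the
functional calculus of an operator whose compression is `T X T* + δ D²`. -/
lemma exists_dilation {T D : H →L[ℂ] H} (hD : star D = D) (hTD : T * star T + D * D = 1)
    {X : H →L[ℂ] H} (hX : IsStrictlyPositive X) {δ : ℝ} (hδ : 0 < δ) :
    ∃ (K : Type u) (_ : NormedAddCommGroup K) (_ : InnerProductSpace ℂ K) (_ : CompleteSpace K)
      (V : H →L[ℂ] K) (Y : K →L[ℂ] K), adjoint V ∘L V = 1 ∧ IsStrictlyPositive Y ∧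
      adjoint V ∘L Y ∘L V = T * X * star T + δ • (D * D) ∧
      ∀ f : ℝ → ℝ, ContinuousOn f (Set.Ioi 0) →
        adjoint V ∘L cfc f Y ∘L V = T * cfc f X * star T + f δ • (D * D) := by
  obtain ⟨K, _, _, _, i, j, hii, hjj, hij, hji, hsum⟩ := exists_orthogonal_double H
  have hii' : ∀ x, adjoint i (i x) = x := fun x => congr($hii x)
  have hjj' : ∀ x, adjoint j (j x) = x := fun x => congr($hjj x)
  have hij' : ∀ x, adjoint i (j x) = 0 := fun x => congr($hij x)
  have hji' : ∀ x, adjoint j (i x) = 0 := fun x => congr($hji x)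
  have hD' : adjoint D = D := hD
  -- `V` is an isometry exactly because `T T* + D² = 1`. The second block of `Y` is the scalar `δ >
  -- 0` rather than `0`, keeping `Y` strictly positive.
  set V : H →L[ℂ] K := i ∘L star T + j ∘L D with hV
  have hVa : adjoint V = T ∘L adjoint i + D ∘L adjoint j := by
    rw [hV, map_add, adjoint_comp, adjoint_comp, hD', star_eq_adjoint, adjoint_adjoint]
  set Y : K →L[ℂ] K := i ∘L X ∘L adjoint i + δ • (j ∘L adjoint j) with hY
  have hYs : IsStrictlyPositive Y := isStrictlyPositive_block_diagonal hsum hX hδ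
  have hYi : Y ∘L i = i ∘L X := by ext x; simp [hY, hii', hji']
  have hYj : Y ∘L j = j ∘L (δ • (1 : H →L[ℂ] H)) := by ext x; simp [hY, hij', hjj']
  have hcomp : ∀ (M : K →L[ℂ] K) (a b : H →L[ℂ] H), M ∘L i = i ∘L a → M ∘L j = j ∘L b →
      adjoint V ∘L M ∘L V = T * a * star T + D * b * D := by
    intro M a b hi hj
    have hMi : ∀ x, M (i x) = i (a x) := fun x => congr($hi x)
    have hMj : ∀ x, M (j x) = j (b x) := fun x => congr($hj x)
    rw [hVa, hV]
    ext x
    simp only [coe_comp, Function.comp_apply, add_apply, map_add, hMi, hMj, hii', hjj', hij', hji',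
      map_zero, add_zero, zero_add]
    rfl
  have hscal : ∀ c : ℝ, D * (c • (1 : H →L[ℂ] H)) * D = c • (D * D) := fun c => by
    rw [mul_smul_comm, mul_one, smul_mul_assoc]
  refine ⟨K, inferInstance, inferInstance, inferInstance, V, Y, ?_, hYs, ?_, ?_⟩
  · have := hcomp 1 1 1 rfl rfl
    rw [mul_one, mul_one, hTD] at this
    exact this
  · rw [hcomp Y X (δ • 1) hYi hYj, hscal]
  · intro f hf
    have hfi := cfc_comp_of_intertwine hX hYs hf hYi
    have hfj := cfc_comp_of_intertwine (isStrictlyPositive_smul_one hδ) hYs hf hYj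
    rw [← Algebra.algebraMap_eq_smul_one, cfc_algebraMap, Algebra.algebraMap_eq_smul_one] at hfj
    rw [hcomp _ _ _ hfi hfj, hscal]

lemma isStrictlyPositive_conj {T X : H →L[ℂ] H} (hT : IsUnit T) (hX : IsStrictlyPositive X) :
    IsStrictlyPositive (T * X * star T) :=
  hT.isStrictlyPositive_star_right_conjugate_iff.2 hX

/-- Removes the auxiliary `δ` of the dilation. The factor `1 + c δ` covers both uses: `c = 1` for
monotone functions, whose compression inequality carries `1 + ε`, and `c = 0` for convex ones. -/
lemma tendsto_cfc_perturbation {T D X : H →L[ℂ] H} (hT : IsUnit T) (hD : star D = D)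
    (hX : IsStrictlyPositive X) {f : ℝ → ℝ} (hf : ContinuousOn f (Set.Ioi 0)) {c : ℝ}
    (hc : 0 ≤ c) :
    Tendsto (fun δ : ℝ => cfc f ((1 + c * δ) • (T * X * star T + δ • (D * D)))) (𝓝[>] 0)
      (𝓝 (cfc f (T * X * star T))) := by
  have hP := isStrictlyPositive_conj hT hX
  obtain ⟨r, hr, hle⟩ := hP.exists_smul_one_le
  have hDD : (0 : H →L[ℂ] H) ≤ D * D := by
    nth_rw 1 [← hD]; exact star_mul_self_nonneg D
  have hlow : ∀ δ : ℝ, 0 < δ → T * X * star T ≤ (1 + c * δ) • (T * X * star T + δ • (D * D)) := by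
    intro δ hδ
    have h1 : (0 : H →L[ℂ] H) ≤ δ • (D * D) := smul_nonneg hδ.le hDD
    have h2 : (0 : H →L[ℂ] H) ≤ (c * δ) • (T * X * star T + δ • (D * D)) :=
      smul_nonneg (by positivity) (add_nonneg hP.nonneg h1)
    rw [add_smul, one_smul, add_assoc]
    exact le_add_of_nonneg_right (add_nonneg h1 h2)
  refine tendsto_cfc_of_smul_one_le hr ?_ ?_ hP.isSelfAdjoint ?_ hle hf
  · have : Continuous fun δ : ℝ => (1 + c * δ) • (T * X * star T + δ • (D * D)) := by fun_prop
    have h := this.tendsto 0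
    simp only [mul_zero, add_zero, zero_smul, one_smul] at h
    exact h.mono_left nhdsWithin_le_nhds
  · filter_upwards [self_mem_nhdsWithin] with δ hδ
    exact (hP.nonneg.trans (hlow δ hδ)).isSelfAdjoint
  · filter_upwards [self_mem_nhdsWithin] with δ hδ
    exact hle.trans (hlow δ hδ)

/-- Hansen's inequality: a nonnegative operator monotone function on `(0, ∞)` satisfies
`T h(X) T* ≤ h(T X T*)` for every invertible contraction `T`. -/
theorem IsOperatorMonotone.conj_cfc_le {h : ℝ → ℝ} (hh : IsOperatorMonotone.{u} h)
    (hpos : ∀ t, 0 < t → 0 ≤ h t) {T X : H →L[ℂ] H} (hT : IsUnit T) (hT1 : T * star T ≤ 1)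
    (hX : IsStrictlyPositive X) :
    T * cfc h X * star T ≤ cfc h (T * X * star T) := by
  obtain ⟨D, hD, hTD⟩ := exists_mul_self_add_eq_one hT1
  have hDD : (0 : H →L[ℂ] H) ≤ D * D := by
    nth_rw 1 [← hD]; exact star_mul_self_nonneg D
  refine ge_of_tendsto (tendsto_cfc_perturbation hT hD hX hh.1 zero_le_one) ?_
  filter_upwards [self_mem_nhdsWithin] with δ hδ
  obtain ⟨K, _, _, _, V, Y, hV, hY, hYV, hfY⟩ := exists_dilation hD hTD hX hδ
  -- The loss parameter `ε` is taken equal to `δ`, so that one limit disposes of both; the term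
  -- `h(δ) D²` is nonnegative and can be dropped.
  have key := hh.compression_cfc_le hV hY hδ
  rw [hfY h hh.1, hYV] at key
  rw [one_mul]
  exact (le_add_of_nonneg_right (smul_nonneg (hpos δ hδ) hDD)).trans key

/-- The Hansen–Pedersen inequality: an operator convex function on `(0, ∞)` with `f(0⁺) = 0`
satisfies `f(T X T*) ≤ T f(X) T*` for every invertible contraction `T`. -/
theorem IsOperatorConvex.cfc_conj_le {f : ℝ → ℝ} (hf : IsOperatorConvex.{u} f)
    (hf0 : Tendsto f (𝓝[>] 0) (𝓝 0)) {T X : H →L[ℂ] H} (hT : IsUnit T) (hT1 : T * star T ≤ 1)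
    (hX : IsStrictlyPositive X) :
    cfc f (T * X * star T) ≤ T * cfc f X * star T := by
  obtain ⟨D, hD, hTD⟩ := exists_mul_self_add_eq_one hT1
  -- Here `f(0⁺) = 0` enters: it kills the contribution `f(δ) D²` of the defect.
  have hlim : Tendsto (fun δ : ℝ => T * cfc f X * star T + f δ • (D * D)) (𝓝[>] 0)
      (𝓝 (T * cfc f X * star T)) := by
    simpa using (hf0.smul_const (D * D)).const_add (T * cfc f X * star T)
  refine le_of_tendsto_of_tendsto (tendsto_cfc_perturbation hT hD hX hf.1 le_rfl) hlim ?_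
  filter_upwards [self_mem_nhdsWithin] with δ hδ
  obtain ⟨K, _, _, _, V, Y, hV, hY, hYV, hfY⟩ := exists_dilation hD hTD hX hδ
  have key := hf.cfc_compression_le hV hY
  rw [hfY f hf.1, hYV] at key
  simpa using key

/-- The reverse Hansen inequality for an expansion `T`. -/
theorem IsOperatorMonotone.cfc_conj_le {h : ℝ → ℝ} (hh : IsOperatorMonotone.{u} h)
    (hpos : ∀ t, 0 < t → 0 ≤ h t) {T X : H →L[ℂ] H} (hT : IsUnit T) (hT1 : 1 ≤ T * star T)
    (hX : IsStrictlyPositive X) :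
    cfc h (T * X * star T) ≤ T * cfc h X * star T := by
  obtain ⟨U, rfl⟩ := hT
  set S : H →L[ℂ] H := ((U⁻¹ : (H →L[ℂ] H)ˣ) : H →L[ℂ] H) with hS
  have hUS : (U : H →L[ℂ] H) * S = 1 := U.mul_inv
  have hSU : S * (U : H →L[ℂ] H) = 1 := U.inv_mul
  have hSU' : star (U : H →L[ℂ] H) * star S = 1 := by rw [← star_mul, hSU, star_one]
  have hUS' : star S * star (U : H →L[ℂ] H) = 1 := by rw [← star_mul, hUS, star_one]
  have hSunit : IsUnit S := (U⁻¹).isUnit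
  have hS1 : S * star S ≤ 1 := by
    have h1 := star_right_conjugate_le_conjugate hT1 S
    rw [mul_one] at h1
    refine h1.trans_eq ?_
    rw [← mul_assoc, hSU, one_mul, hSU']
  -- The inverse of an expansion is a contraction; Hansen's inequality for `S = T⁻¹` at `T X T*` is
  -- conjugated back by `T`.
  have key := hh.conj_cfc_le hpos hSunit hS1 (isStrictlyPositive_conj U.isUnit hX)
  have e : S * (U * X * star (U : H →L[ℂ] H)) * star S = X := by
    rw [mul_assoc, mul_assoc, hSU', mul_one, ← mul_assoc, hSU, one_mul]
  rw [e] at key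
  have h2 := star_right_conjugate_le_conjugate key (U : H →L[ℂ] H)
  refine le_trans (le_of_eq ?_) h2
  simp only [mul_assoc]
  rw [hUS', mul_one, ← mul_assoc (U : H →L[ℂ] H) S, hUS, one_mul]

end Contraction

/-! ### The Kantorovich inequality for powers -/

section Kantorovich

open ContinuousLinearMap

/-- A line which dominates `s ^ q` on `[1, ξ]` and is dominated by `K(ξ, q) s ^ q` on `(0, ∞)`. -/
lemma exists_affine_between_rpow_normalized {ξ q : ℝ} (hξ : 1 ≤ ξ) (hq : 1 ≤ q) :
    ∃ α β : ℝ, 0 ≤ α ∧ (∀ s ∈ Set.Icc 1 ξ, s ^ q ≤ α * s + β) ∧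
      ∀ s : ℝ, 0 < s → α * s + β ≤ kantorovichConst ξ q * s ^ q := by
  rcases hq.eq_or_lt with rfl | hq1
  · exact ⟨1, 0, zero_le_one, fun s _ => by simp, fun s _ => by simp [kantorovichConst]⟩
  have bernoulli : ∀ w : ℝ, 0 ≤ w → q * w ≤ (q - 1) + w ^ q := fun w hw => by
    have := one_add_mul_self_le_rpow_one_add (s := w - 1) (by linarith) hq
    rw [add_sub_cancel] at this
    linarith
  rcases hξ.eq_or_lt with rfl | hξ1
  · refine ⟨q, 1 - q, by linarith, fun s hs => ?_, fun s hs => ?_⟩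
    · obtain rfl : s = 1 := le_antisymm hs.2 hs.1
      simp
    · have := bernoulli s hs.le
      simp only [kantorovichConst, or_true, if_true]
      linarith
  have hξ0 : 0 < ξ - 1 := sub_pos.2 hξ1
  -- The line is the chord `a s - d` of `s ^ q` over `[1, ξ]`: convexity puts it above the power
  -- there.
  set a := (ξ ^ q - 1) / (ξ - 1) with ha
  set d := (ξ ^ q - ξ) / (ξ - 1) with hd
  have hpow : ξ < ξ ^ q := by
    simpa using Real.rpow_lt_rpow_of_exponent_lt hξ1 hq1
  have had : a = 1 + d := by
    rw [ha, hd]; field_simp; ring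
  have hd0 : 0 < d := div_pos (sub_pos.2 hpow) hξ0
  have ha0 : 0 < a := by linarith
  refine ⟨a, -d, ha0.le, fun s hs => ?_, fun s hs => ?_⟩
  · have hw1 : 0 ≤ (ξ - s) / (ξ - 1) := div_nonneg (by linarith [hs.2]) hξ0.le
    have hw2 : 0 ≤ (s - 1) / (ξ - 1) := div_nonneg (by linarith [hs.1]) hξ0.le
    have hconv := (convexOn_rpow hq).2 (Set.mem_Ici.2 zero_le_one)
      (Set.mem_Ici.2 (by linarith : (0 : ℝ) ≤ ξ)) hw1 hw2 (by field_simp; ring)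
    have e1 : (ξ - s) / (ξ - 1) * 1 + (s - 1) / (ξ - 1) * ξ = s := by field_simp; ring
    have e2 : (ξ - s) / (ξ - 1) * 1 + (s - 1) / (ξ - 1) * ξ ^ q = a * s + -d := by
      rw [ha, hd]; field_simp; ring
    simp only [smul_eq_mul, Real.one_rpow] at hconv
    rwa [e1, e2] at hconv
  · have hK : kantorovichConst ξ q = d / (q - 1) * ((q - 1) / q * (a / d)) ^ q := by
      rw [kantorovichConst, if_neg (by push Not; exact ⟨hq1.ne', hξ1.ne'⟩), ha, hd,
        div_div_div_cancel_right₀ hξ0.ne', div_div, mul_comm (q - 1) (ξ - 1)]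
    have hc0 : 0 ≤ (q - 1) / q * (a / d) := by
      have : 0 < q - 1 := by linarith
      positivity
    -- Bernoulli is sharp at `w = 1`, so the scaling of `s` is chosen to make `w = 1` at the point
    -- where the chord touches `K(ξ, q) s ^ q`.
    have hw := bernoulli ((q - 1) / q * (a / d) * s) (by positivity)
    rw [Real.mul_rpow hc0 hs.le] at hw
    have hq0 : 0 < q - 1 := by linarith
    have hmul := mul_le_mul_of_nonneg_left hw (div_nonneg hd0.le hq0.le)
    have e1 : d / (q - 1) * (q * ((q - 1) / q * (a / d) * s)) = a * s := by
      field_simp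
    have e2 : d / (q - 1) * ((q - 1) + ((q - 1) / q * (a / d)) ^ q * s ^ q) =
        d + kantorovichConst ξ q * s ^ q := by
      rw [hK]; field_simp
    linarith

/-- Rescaling by `m` turns `[m, M]` into `[1, M / m]`. The condition `0 ≤ α` is what lets the affine
function preserve the operator order. -/
lemma exists_affine_between_rpow {m M q : ℝ} (hm : 0 < m) (hmM : m ≤ M) (hq : 1 ≤ q) :
    ∃ α β : ℝ, 0 ≤ α ∧ (∀ t ∈ Set.Icc m M, t ^ q ≤ α * t + β) ∧
      ∀ t : ℝ, 0 < t → α * t + β ≤ kantorovichConst (M / m) q * t ^ q := by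
  obtain ⟨α, β, hα, h1, h2⟩ :=
    exists_affine_between_rpow_normalized ((one_le_div hm).2 hmM) hq
  have hmq : 0 < m ^ q := Real.rpow_pos_of_pos hm q
  have hscale : ∀ t : ℝ, 0 < t → t ^ q = m ^ q * (t / m) ^ q := fun t ht => by
    rw [← Real.mul_rpow hm.le (by positivity), mul_div_cancel₀ _ hm.ne']
  have hlin : ∀ t : ℝ, m ^ q * α / m * t + m ^ q * β = m ^ q * (α * (t / m) + β) := fun t => by
    field_simp
  refine ⟨m ^ q * α / m, m ^ q * β, by positivity, fun t ht => ?_, fun t ht => ?_⟩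
  · rw [hscale t (hm.trans_le ht.1), hlin]
    exact mul_le_mul_of_nonneg_left (h1 _ ⟨(one_le_div hm).2 ht.1,
      div_le_div_of_nonneg_right ht.2 hm.le⟩) hmq.le
  · rw [hscale t ht, hlin, mul_left_comm]
    exact mul_le_mul_of_nonneg_left (h2 _ (by positivity)) hmq.le

lemma one_le_kantorovichConst {ξ q : ℝ} (hξ : 1 ≤ ξ) (hq : 1 ≤ q) :
    1 ≤ kantorovichConst ξ q := by
  obtain ⟨α, β, -, h1, h2⟩ := exists_affine_between_rpow_normalized hξ hq
  have h := (h1 1 ⟨le_rfl, hξ⟩).trans (h2 1 one_pos)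
  simpa using h

variable {H : Type u} [NormedAddCommGroup H] [InnerProductSpace ℂ H] [CompleteSpace H]

lemma continuousOn_rpow_Ioi (y : ℝ) : ContinuousOn (fun x : ℝ => x ^ y) (Set.Ioi 0) :=
  fun x hx => (Real.continuousAt_rpow_const x y (Or.inl (ne_of_gt hx))).continuousWithinAt

lemma IsStrictlyPositive.cfc_le_cfc {a : H →L[ℂ] H} (ha : IsStrictlyPositive a) {f g : ℝ → ℝ}
    (hf : ContinuousOn f (Set.Ioi 0)) (hg : ContinuousOn g (Set.Ioi 0))
    (h : ∀ x ∈ spectrum ℝ a, f x ≤ g x) : cfc f a ≤ cfc g a :=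
  cfc_mono h (hf.mono ha.spectrum_subset_Ioi) (hg.mono ha.spectrum_subset_Ioi)

lemma IsStrictlyPositive.cfc_mul_cfc {a : H →L[ℂ] H} (ha : IsStrictlyPositive a) {f g : ℝ → ℝ}
    (hf : ContinuousOn f (Set.Ioi 0)) (hg : ContinuousOn g (Set.Ioi 0)) :
    cfc f a * cfc g a = cfc (fun x => f x * g x) a :=
  (cfc_mul f g a (hf.mono ha.spectrum_subset_Ioi) (hg.mono ha.spectrum_subset_Ioi)).symm

lemma IsStrictlyPositive.cfc_congr_of_pos {a : H →L[ℂ] H} (ha : IsStrictlyPositive a)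
    {f g : ℝ → ℝ} (h : ∀ x, 0 < x → f x = g x) : cfc f a = cfc g a :=
  cfc_congr fun _ hx => h _ (ha.spectrum_pos hx)

lemma IsStrictlyPositive.rpow_eq_cfc {a : H →L[ℂ] H} (ha : IsStrictlyPositive a) (y : ℝ) :
    a ^ y = cfc (fun x : ℝ => x ^ y) a :=
  CFC.rpow_eq_cfc_real ha.nonneg

lemma IsStrictlyPositive.cfc_rpow_eq {a : H →L[ℂ] H} (ha : IsStrictlyPositive a) {f : ℝ → ℝ}
    (hf : ContinuousOn f (Set.Ioi 0)) (hpos : ∀ t, 0 < t → 0 < f t) (y : ℝ) :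
    cfc f a ^ y = cfc (fun x => f x ^ y) a :=
  CFC.cfc_rpow (fun x hx => hpos x (ha.spectrum_pos hx)) (hf.mono ha.spectrum_subset_Ioi)
    ha.isSelfAdjoint

lemma IsStrictlyPositive.cfc_comp_rpow {a : H →L[ℂ] H} (ha : IsStrictlyPositive a) {f : ℝ → ℝ}
    (hf : ContinuousOn f (Set.Ioi 0)) (y : ℝ) :
    cfc f (a ^ y) = cfc (fun x => f (x ^ y)) a := by
  have himg : (fun x : ℝ => x ^ y) '' spectrum ℝ a ⊆ Set.Ioi 0 := by
    rintro _ ⟨x, hx, rfl⟩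
    exact Real.rpow_pos_of_pos (ha.spectrum_pos hx) y
  rw [ha.rpow_eq_cfc]
  exact (cfc_comp' f (fun x : ℝ => x ^ y) a (hf.mono himg)
    ((continuousOn_rpow_Ioi y).mono ha.spectrum_subset_Ioi) ha.isSelfAdjoint).symm

lemma ContinuousOn.rpow_const_of_pos {f : ℝ → ℝ} (hf : ContinuousOn f (Set.Ioi 0))
    (hpos : ∀ t, 0 < t → 0 < f t) (y : ℝ) : ContinuousOn (fun x => f x ^ y) (Set.Ioi 0) :=
  hf.rpow_const fun x hx => Or.inl (hpos x hx).ne'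

lemma ContinuousOn.comp_rpow_Ioi {f : ℝ → ℝ} (hf : ContinuousOn f (Set.Ioi 0)) (y : ℝ) :
    ContinuousOn (fun x : ℝ => f (x ^ y)) (Set.Ioi 0) :=
  hf.comp (continuousOn_rpow_Ioi y) fun _ hx => Real.rpow_pos_of_pos hx y

/-- The Kantorovich inequality for operators: the power function `t ^ q`, `q ≥ 1`, is operator
monotone up to the constant `K(M / m, q)`. -/
theorem rpow_le_kantorovichConst_smul_rpow {X Y : H →L[ℂ] H} (hX : IsStrictlyPositive X)
    (hXY : X ≤ Y) {m M q : ℝ} (hm : 0 < m) (hmM : m ≤ M) (hspec : spectrum ℝ X ⊆ Set.Icc m M)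
    (hq : 1 ≤ q) :
    X ^ q ≤ kantorovichConst (M / m) q • Y ^ q := by
  have hY := hX.of_le hXY
  obtain ⟨α, β, hα, h1, h2⟩ := exists_affine_between_rpow hm hmM hq
  have haff : ∀ Z : H →L[ℂ] H, IsStrictlyPositive Z →
      cfc (fun t => α * t + β) Z = α • Z + algebraMap ℝ _ β := fun Z hZ => by
    have := hZ.isSelfAdjoint
    rw [cfc_add_const β (fun t => α * t) Z, cfc_const_mul_id α Z]
  have hcont : ContinuousOn (fun t : ℝ => α * t + β) (Set.Ioi 0) := by fun_prop
  calc X ^ q = cfc (fun t : ℝ => t ^ q) X := hX.rpow_eq_cfc q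
    _ ≤ cfc (fun t => α * t + β) X :=
        hX.cfc_le_cfc (continuousOn_rpow_Ioi q) hcont fun x hx => h1 x (hspec hx)
    _ = α • X + algebraMap ℝ _ β := haff X hX
    _ ≤ α • Y + algebraMap ℝ _ β := by gcongr
    _ = cfc (fun t => α * t + β) Y := (haff Y hY).symm
    _ ≤ cfc (fun t => kantorovichConst (M / m) q * t ^ q) Y :=
        hY.cfc_le_cfc hcont (continuousOn_const.mul (continuousOn_rpow_Ioi q))
          fun x hx => h2 x (hY.spectrum_pos hx)
    _ = kantorovichConst (M / m) q • Y ^ q := by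
        rw [cfc_const_mul _ _ Y ((continuousOn_rpow_Ioi q).mono hY.spectrum_subset_Ioi),
          hY.rpow_eq_cfc]

end Kantorovich

/-! ### Operator perspectives via operator monotone functions -/

section Perspective

variable {H : Type u} [NormedAddCommGroup H] [InnerProductSpace ℂ H] [CompleteSpace H]

lemma star_rpow (A : H →L[ℂ] H) (x : ℝ) : star (A ^ x) = A ^ x :=
  (CFC.rpow_nonneg (a := A) (y := x)).isSelfAdjoint

lemma IsStrictlyPositive.rpow_mul_rpow {A : H →L[ℂ] H} (hA : IsStrictlyPositive A) (x y : ℝ) :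
    A ^ x * A ^ y = A ^ (x + y) :=
  (CFC.rpow_add hA.isUnit).symm

/-- Reassociated form of `IsStrictlyPositive.rpow_mul_rpow`. -/
lemma IsStrictlyPositive.rpow_mul_rpow_mul {A : H →L[ℂ] H} (hA : IsStrictlyPositive A) (x y : ℝ)
    (Z : H →L[ℂ] H) : A ^ x * (A ^ y * Z) = A ^ (x + y) * Z := by
  rw [← mul_assoc, hA.rpow_mul_rpow]

lemma IsStrictlyPositive.rpow_pos {A : H →L[ℂ] H} (hA : IsStrictlyPositive A) (x : ℝ) :
    IsStrictlyPositive (A ^ x) := IsStrictlyPositive.rpow A x hA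

lemma IsStrictlyPositive.isUnit_rpow {A : H →L[ℂ] H} (hA : IsStrictlyPositive A) (x : ℝ) :
    IsUnit (A ^ x) := (hA.rpow_pos x).isUnit

lemma rpow_conj_mono {X Y : H →L[ℂ] H} (h : X ≤ Y) (A : H →L[ℂ] H) (x : ℝ) :
    A ^ x * X * A ^ x ≤ A ^ x * Y * A ^ x := by
  have := star_right_conjugate_le_conjugate h (A ^ x)
  rwa [star_rpow] at this

lemma isStrictlyPositive_relativeOperator {A B : H →L[ℂ] H} (hA : IsStrictlyPositive A)
    (hB : IsStrictlyPositive B) : IsStrictlyPositive (relativeOperator A B) := by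
  have := isStrictlyPositive_conj (hA.isUnit_rpow (1 / 2)) (hB.rpow_pos (-1))
  rwa [star_rpow] at this

lemma isStrictlyPositive_rpow_neg_conj {A B : H →L[ℂ] H} (hA : IsStrictlyPositive A)
    (hB : IsStrictlyPositive B) :
    IsStrictlyPositive (B ^ (-(1 / 2) : ℝ) * A * B ^ (-(1 / 2) : ℝ)) := by
  have := isStrictlyPositive_conj (hB.isUnit_rpow (-(1 / 2))) hA
  rwa [star_rpow] at this

/-- If `f` is operator convex with `f(0⁺) = 0`, then `f(t) / t` is operator monotone. -/
theorem IsOperatorConvex.isOperatorMonotone_div {f : ℝ → ℝ} (hf : IsOperatorConvex.{u} f)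
    (hf0 : Tendsto f (𝓝[>] 0) (𝓝 0)) : IsOperatorMonotone.{u} (fun t => f t / t) := by
  have hcont : ContinuousOn (fun t => f t / t) (Set.Ioi 0) :=
    hf.1.div continuousOn_id fun x hx => ne_of_gt hx
  refine ⟨hcont, fun K _ _ _ A B hA hAB => ?_⟩
  have hB := hA.of_le hAB
  have hconj : ∀ Z : K →L[ℂ] K, IsStrictlyPositive Z →
      Z ^ (-(1 / 2) : ℝ) * cfc f Z * Z ^ (-(1 / 2) : ℝ) = cfc (fun t => f t / t) Z := by
    intro Z hZ
    have hc : ContinuousOn (fun x : ℝ => x ^ (-(1 / 2) : ℝ) * f x) (Set.Ioi 0) :=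
      (continuousOn_rpow_Ioi _).mul hf.1
    rw [hZ.rpow_eq_cfc, hZ.cfc_mul_cfc (continuousOn_rpow_Ioi _) hf.1,
      hZ.cfc_mul_cfc hc (continuousOn_rpow_Ioi _)]
    refine hZ.cfc_congr_of_pos fun x hx => ?_
    rw [mul_comm (x ^ _) (f x), mul_assoc, ← Real.rpow_add hx]
    norm_num
    rw [Real.rpow_neg_one, div_eq_mul_inv]
  -- From `A ≤ B`, `T` is a contraction with `T B T* = A`, so Hansen–Pedersen compares `f(A)` with
  -- `T f(B) T*`.
  set T : K →L[ℂ] K := A ^ (1 / 2 : ℝ) * B ^ (-(1 / 2) : ℝ) with hT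
  have hTs : star T = B ^ (-(1 / 2) : ℝ) * A ^ (1 / 2 : ℝ) := by
    rw [hT, star_mul, star_rpow, star_rpow]
  have hTu : IsUnit T := (hA.isUnit_rpow _).mul (hB.isUnit_rpow _)
  have hT1 : T * star T ≤ 1 := by
    have h := rpow_conj_mono (CStarAlgebra.rpow_neg_one_le_rpow_neg_one hAB hA) A (1 / 2)
    have e1 : T * star T = A ^ (1 / 2 : ℝ) * B ^ (-1 : ℝ) * A ^ (1 / 2 : ℝ) := by
      rw [hTs, hT, mul_assoc, hB.rpow_mul_rpow_mul]
      norm_num [mul_assoc]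
    have e2 : A ^ (1 / 2 : ℝ) * A ^ (-1 : ℝ) * A ^ (1 / 2 : ℝ) = 1 := by
      rw [hA.rpow_mul_rpow, hA.rpow_mul_rpow]
      norm_num
      exact CFC.rpow_zero A hA.nonneg
    rwa [← e1, e2] at h
  have hTBT : T * B * star T = A := by
    nth_rw 1 [← CFC.rpow_one B hB.nonneg]
    rw [hTs, hT, mul_assoc, mul_assoc, hB.rpow_mul_rpow_mul, hB.rpow_mul_rpow_mul]
    norm_num
    rw [CFC.rpow_zero B hB.nonneg, one_mul, hA.rpow_mul_rpow]
    norm_num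
    exact CFC.rpow_one A hA.nonneg
  have key := rpow_conj_mono (hf.cfc_conj_le hf0 hTu hT1 hB) A (-(1 / 2))
  rw [hTBT, hconj A hA] at key
  refine key.trans_eq ?_
  rw [← hconj B hB, hTs, hT]
  simp only [mul_assoc]
  rw [hA.rpow_mul_rpow_mul, hA.rpow_mul_rpow]
  norm_num
  rw [CFC.rpow_zero A hA.nonneg, one_mul, mul_one]

/-- The perspective of `f` in terms of `f(t) / t` and `A^{1/2} B⁻¹ A^{1/2}`. -/
theorem operatorPerspective_eq_relativeOperator {A B : H →L[ℂ] H} (hA : IsStrictlyPositive A)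
    (hB : IsStrictlyPositive B) {f : ℝ → ℝ} (hf : ContinuousOn f (Set.Ioi 0)) :
    operatorPerspective f A B =
      A ^ (1 / 2 : ℝ) * cfc (fun t => f t / t) (relativeOperator A B) * A ^ (1 / 2 : ℝ) := by
  have hcont : ContinuousOn (fun t => f t / t) (Set.Ioi 0) :=
    hf.div continuousOn_id fun x hx => ne_of_gt hx
  set M := B ^ (-(1 / 2) : ℝ) * A * B ^ (-(1 / 2) : ℝ) with hM
  have hMs : IsStrictlyPositive M := isStrictlyPositive_rpow_neg_conj hA hB
  have hA1 : A ^ (1 / 2 : ℝ) * A ^ (1 / 2 : ℝ) = A := by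
    rw [hA.rpow_mul_rpow]; norm_num; exact CFC.rpow_one A hA.nonneg
  -- With `X = A^{1/2} B^{-1/2}`, `M = X* X` and the relative operator is `X X*`; hence `X`
  -- intertwines them.
  have hMX : M = B ^ (-(1 / 2) : ℝ) * A ^ (1 / 2 : ℝ) * (A ^ (1 / 2 : ℝ) * B ^ (-(1 / 2) : ℝ)) := by
    rw [hM]
    nth_rw 1 [← hA1]
    simp only [mul_assoc]
  have hCX : relativeOperator A B =
      A ^ (1 / 2 : ℝ) * B ^ (-(1 / 2) : ℝ) * (B ^ (-(1 / 2) : ℝ) * A ^ (1 / 2 : ℝ)) := by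
    rw [relativeOperator, mul_assoc (A ^ _) (B ^ _) (_ * _), hB.rpow_mul_rpow_mul]
    norm_num [mul_assoc]
  have hint := cfc_mul_of_intertwine (T := A ^ (1 / 2 : ℝ) * B ^ (-(1 / 2) : ℝ)) hMs
    (isStrictlyPositive_relativeOperator hA hB) hcont (by
      rw [hCX, hMX]; simp only [mul_assoc])
  have hfM : cfc f M = M * cfc (fun t => f t / t) M := by
    nth_rw 2 [← cfc_id ℝ M hMs.isSelfAdjoint]
    rw [hMs.cfc_mul_cfc continuousOn_id hcont]
    exact hMs.cfc_congr_of_pos fun x hx => by simp [mul_div_cancel₀ _ hx.ne']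
  rw [operatorPerspective, ← hM, hfM]
  nth_rw 1 [hMX]
  rw [mul_assoc (B ^ _ * A ^ _) (A ^ _ * B ^ _) _, ← hint]
  simp only [mul_assoc]
  rw [hB.rpow_mul_rpow_mul, hB.rpow_mul_rpow]
  norm_num
  rw [CFC.rpow_zero B hB.nonneg, one_mul, mul_one]

lemma rpow_conj_mul_relativeOperator {A B : H →L[ℂ] H} (hA : IsStrictlyPositive A)
    (hB : IsStrictlyPositive B) :
    B ^ (-(1 / 2) : ℝ) * A * B ^ (-(1 / 2) : ℝ) * relativeOperator B A = 1 := by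
  rw [relativeOperator]
  simp only [mul_assoc]
  rw [hB.rpow_mul_rpow_mul]
  have hAA : A * A ^ (-1 : ℝ) = 1 := by
    simpa [CFC.rpow_one A hA.nonneg] using CFC.rpow_mul_rpow_neg 1 hA
  norm_num
  rw [CFC.rpow_zero B hB.nonneg, one_mul, ← mul_assoc A, hAA, one_mul, hB.rpow_mul_rpow]
  norm_num
  exact CFC.rpow_zero B hB.nonneg

/-- The operator `B^{-1/2} A B^{-1/2}` is the inverse of `B^{1/2} A⁻¹ B^{1/2}`. -/
lemma exists_unit_relativeOperator {A B : H →L[ℂ] H} (hA : IsStrictlyPositive A)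
    (hB : IsStrictlyPositive B) :
    ∃ u : (H →L[ℂ] H)ˣ, (u : H →L[ℂ] H) = relativeOperator B A ∧
      ((u⁻¹ : (H →L[ℂ] H)ˣ) : H →L[ℂ] H) = B ^ (-(1 / 2) : ℝ) * A * B ^ (-(1 / 2) : ℝ) := by
  obtain ⟨u, hu⟩ := (isStrictlyPositive_relativeOperator hB hA).isUnit
  refine ⟨u, hu, u.inv_eq_of_mul_eq_one_left ?_⟩
  rw [hu]
  exact rpow_conj_mul_relativeOperator hA hB

/-- The perspective of `g` in terms of `g(1 / t)` and `B^{1/2} A⁻¹ B^{1/2}`. -/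
theorem operatorPerspective_eq_relativeOperator_swap {A B : H →L[ℂ] H} (hA : IsStrictlyPositive A)
    (hB : IsStrictlyPositive B) {g : ℝ → ℝ} (hg : ContinuousOn g (Set.Ioi 0)) :
    operatorPerspective g A B =
      B ^ (1 / 2 : ℝ) * cfc (fun t => g t⁻¹) (relativeOperator B A) * B ^ (1 / 2 : ℝ) := by
  obtain ⟨u, hu, hu'⟩ := exists_unit_relativeOperator hA hB
  have hus := isStrictlyPositive_relativeOperator hB hA
  have himg : (fun x : ℝ => x⁻¹) '' spectrum ℝ (u : H →L[ℂ] H) ⊆ Set.Ioi 0 := by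
    rintro _ ⟨x, hx, rfl⟩
    rw [hu] at hx
    exact inv_pos.2 (hus.spectrum_pos hx)
  rw [operatorPerspective, ← hu, ← hu',
    cfc_comp_inv g u (hg.mono himg) (hu ▸ hus.isSelfAdjoint)]

/-- The spectra of `B^{1/2} A⁻¹ B^{1/2}` and `A^{1/2} B⁻¹ A^{1/2}` are inverse to each other. -/
lemma inv_mem_spectrum_relativeOperator {A B : H →L[ℂ] H} (hA : IsStrictlyPositive A)
    (hB : IsStrictlyPositive B) {x : ℝ} (hx : x ∈ spectrum ℝ (relativeOperator B A)) :
    x⁻¹ ∈ spectrum ℝ (relativeOperator A B) := by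
  obtain ⟨u, hu, hu'⟩ := exists_unit_relativeOperator hA hB
  have hx0 := (isStrictlyPositive_relativeOperator hB hA).spectrum_pos hx
  have h1 : x⁻¹ ∈ spectrum ℝ ((u⁻¹ : (H →L[ℂ] H)ˣ) : H →L[ℂ] H) := by
    rw [← spectrum.inv₀_mem_iff, inv_inv, hu]
    exact hx
  have hA1 : A ^ (1 / 2 : ℝ) * A ^ (1 / 2 : ℝ) = A := by
    rw [hA.rpow_mul_rpow]; norm_num; exact CFC.rpow_one A hA.nonneg
  have e1 : ((u⁻¹ : (H →L[ℂ] H)ˣ) : H →L[ℂ] H) =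
      B ^ (-(1 / 2) : ℝ) * A ^ (1 / 2 : ℝ) * (A ^ (1 / 2 : ℝ) * B ^ (-(1 / 2) : ℝ)) := by
    rw [hu']
    nth_rw 1 [← hA1]
    simp only [mul_assoc]
  have e2 : relativeOperator A B =
      A ^ (1 / 2 : ℝ) * B ^ (-(1 / 2) : ℝ) * (B ^ (-(1 / 2) : ℝ) * A ^ (1 / 2 : ℝ)) := by
    rw [relativeOperator, mul_assoc (A ^ _) (B ^ _) (_ * _), hB.rpow_mul_rpow_mul]
    norm_num [mul_assoc]
  -- `X X*` and `X* X` have the same nonzero spectrum.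
  have h2 : x⁻¹ ∈ spectrum ℝ (relativeOperator A B) \ {0} := by
    rw [e2, spectrum.nonzero_mul_comm, ← e1]
    exact ⟨h1, (inv_pos.2 hx0).ne'⟩
  exact h2.1

end Perspective

/-! ### Powers of the relative operator and of operator inequalities -/

section PowerInequalities

variable {H : Type u} [NormedAddCommGroup H] [InnerProductSpace ℂ H] [CompleteSpace H]

lemma IsStrictlyPositive.rpow_conj_rpow_eq_one {A : H →L[ℂ] H} (hA : IsStrictlyPositive A)
    {x y : ℝ} (h : x + y + x = 0) : A ^ x * A ^ y * A ^ x = 1 := by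
  rw [hA.rpow_mul_rpow, hA.rpow_mul_rpow, h, CFC.rpow_zero A hA.nonneg]

lemma rpow_neg_conj_relativeOperator {A B : H →L[ℂ] H} (hA : IsStrictlyPositive A) :
    A ^ (-(1 / 2) : ℝ) * relativeOperator A B * A ^ (-(1 / 2) : ℝ) = B ^ (-1 : ℝ) := by
  rw [relativeOperator]
  simp only [mul_assoc]
  rw [hA.rpow_mul_rpow_mul, hA.rpow_mul_rpow]
  norm_num
  rw [CFC.rpow_zero A hA.nonneg, one_mul, mul_one]

/-- Put `R = A^{-1/2} C^{1/2}`. Then `B⁻¹ = R R*`, and `(R R*)^p = R (R* R)^{p-1} R*` because `R`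
intertwines `R* R` with `R R*`. This lowers the exponent from `p` to `p - 1`, within the range of
Löwner–Heinz. -/
lemma relativeOperator_rpow {A B : H →L[ℂ] H} (hA : IsStrictlyPositive A)
    (hB : IsStrictlyPositive B) {p : ℝ} (hp : p ≠ 0) :
    relativeOperator (A ^ p) (B ^ p) = A ^ ((p - 1) / 2) *
      (relativeOperator A B ^ (1 / 2 : ℝ) *
        (relativeOperator A B ^ (1 / 2 : ℝ) * A ^ (-1 : ℝ) * relativeOperator A B ^ (1 / 2 : ℝ)) ^
          (p - 1) * relativeOperator A B ^ (1 / 2 : ℝ)) * A ^ ((p - 1) / 2) := by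
  have hC := isStrictlyPositive_relativeOperator hA hB
  have hb := rpow_neg_conj_relativeOperator (B := B) hA
  rw [relativeOperator, CFC.rpow_rpow A p _ hp hA, CFC.rpow_rpow B p _ hp hB,
    show p * -1 = -1 * p by ring, ← CFC.rpow_rpow B (-1) p (by norm_num) hB, ← hb]
  set C := relativeOperator A B with hCdef
  have hbs : IsStrictlyPositive (A ^ (-(1 / 2) : ℝ) * C * A ^ (-(1 / 2) : ℝ)) := by
    rw [hb]; exact hB.rpow_pos _
  have hN : IsStrictlyPositive (C ^ (1 / 2 : ℝ) * A ^ (-1 : ℝ) * C ^ (1 / 2 : ℝ)) := by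
    have := isStrictlyPositive_conj (hC.isUnit_rpow (1 / 2)) (hA.rpow_pos (-1))
    rwa [star_rpow] at this
  have hCC : C ^ (1 / 2 : ℝ) * C ^ (1 / 2 : ℝ) = C := by
    rw [hC.rpow_mul_rpow]; norm_num; exact CFC.rpow_one C hC.nonneg
  have hint := cfc_mul_of_intertwine (T := A ^ (-(1 / 2) : ℝ) * C ^ (1 / 2 : ℝ)) hN hbs
    (continuousOn_rpow_Ioi (p - 1)) (by
      nth_rw 1 [← hCC]
      simp only [mul_assoc]
      rw [hA.rpow_mul_rpow_mul]
      norm_num)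
  rw [← hbs.rpow_eq_cfc, ← hN.rpow_eq_cfc] at hint
  set b := A ^ (-(1 / 2) : ℝ) * C * A ^ (-(1 / 2) : ℝ) with hbdef
  have hbp : b ^ p = A ^ (-(1 / 2) : ℝ) * C ^ (1 / 2 : ℝ) *
      (C ^ (1 / 2 : ℝ) * A ^ (-1 : ℝ) * C ^ (1 / 2 : ℝ)) ^ (p - 1) *
        (C ^ (1 / 2 : ℝ) * A ^ (-(1 / 2) : ℝ)) := by
    rw [← hint]
    have h1 : b ^ p = b ^ (p - 1) * b := by
      nth_rw 3 [← CFC.rpow_one b hbs.nonneg]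
      rw [hbs.rpow_mul_rpow, sub_add_cancel]
    rw [h1, mul_assoc]
    nth_rw 2 [hbdef]
    nth_rw 1 [← hCC]
    simp only [mul_assoc]
  rw [hbp]
  simp only [mul_assoc]
  rw [hA.rpow_mul_rpow_mul, hA.rpow_mul_rpow]
  have e1 : p * (1 / 2) + -(1 / 2) = (p - 1) / 2 := by ring
  have e2 : -(1 / 2) + p * (1 / 2) = (p - 1) / 2 := by ring
  rw [e1, e2]

lemma inv_spectrum_subset {A : H →L[ℂ] H} (hA : IsStrictlyPositive A) {m M : ℝ} (hm : 0 < m)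
    (hspec : spectrum ℝ A ⊆ Set.Icc m M) :
    spectrum ℝ (A ^ (-1 : ℝ)) ⊆ Set.Icc M⁻¹ m⁻¹ := by
  rw [hA.rpow_eq_cfc, cfc_map_spectrum (fun x : ℝ => x ^ (-1 : ℝ)) A hA.isSelfAdjoint
    ((continuousOn_rpow_Ioi _).mono hA.spectrum_subset_Ioi)]
  rintro _ ⟨x, hx, rfl⟩
  have h := hspec hx
  simp only [Real.rpow_neg_one]
  exact ⟨inv_anti₀ (hm.trans_le h.1) h.2, inv_anti₀ hm h.1⟩

lemma rpow_neg_one_rpow {A : H →L[ℂ] H} (hA : IsStrictlyPositive A) (x : ℝ) :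
    (A ^ (-1 : ℝ)) ^ x = A ^ (-x) := by
  rw [CFC.rpow_rpow A (-1) x (by norm_num) hA, neg_one_mul]

theorem rpow_neg_le_kantorovichConst_smul_rpow {A G : H →L[ℂ] H} (hA : IsStrictlyPositive A)
    (h : A ^ (-1 : ℝ) ≤ G) {m M q : ℝ} (hm : 0 < m) (hmM : m ≤ M)
    (hspec : spectrum ℝ A ⊆ Set.Icc m M) (hq : 1 ≤ q) :
    A ^ (-q) ≤ kantorovichConst (M / m) q • G ^ q := by
  have key := rpow_le_kantorovichConst_smul_rpow (hA.rpow_pos (-1)) h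
    (inv_pos.2 (hm.trans_le hmM)) (inv_anti₀ hm hmM) (inv_spectrum_subset hA hm hspec) hq
  rwa [rpow_neg_one_rpow hA, inv_div_inv] at key

/-- The Kantorovich inequality needs spectral bounds on the smaller operator, but here they are
known for the larger one. Inverting makes `A` the smaller operator; inverting the result back gives
the claim. -/
theorem rpow_le_kantorovichConst_smul_rpow_neg {A G : H →L[ℂ] H} (hA : IsStrictlyPositive A)
    (hG : IsStrictlyPositive G) (h : G ≤ A ^ (-1 : ℝ)) {m M q : ℝ} (hm : 0 < m) (hmM : m ≤ M)
    (hspec : spectrum ℝ A ⊆ Set.Icc m M) (hq : 1 ≤ q) :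
    G ^ q ≤ kantorovichConst (M / m) q • A ^ (-q) := by
  have hK : 0 < kantorovichConst (M / m) q :=
    one_pos.trans_le (one_le_kantorovichConst ((one_le_div hm).2 hmM) hq)
  have h1 := CStarAlgebra.rpow_neg_one_le_rpow_neg_one h hG
  rw [rpow_neg_one_rpow hA, neg_neg, CFC.rpow_one A hA.nonneg] at h1
  have h2 := rpow_le_kantorovichConst_smul_rpow hA h1 hm hmM hspec hq
  have h3 := CStarAlgebra.rpow_neg_one_le_rpow_neg_one h2 (hA.rpow_pos q)
  have hcont : ContinuousOn (fun t : ℝ => kantorovichConst (M / m) q * t ^ (-q)) (Set.Ioi 0) :=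
    continuousOn_const.mul (continuousOn_rpow_Ioi _)
  have e : (kantorovichConst (M / m) q • (G ^ (-1 : ℝ)) ^ q) ^ (-1 : ℝ) =
      (kantorovichConst (M / m) q)⁻¹ • G ^ q := by
    rw [rpow_neg_one_rpow hG, hG.rpow_eq_cfc,
      ← cfc_const_mul _ _ G ((continuousOn_rpow_Ioi (-q)).mono hG.spectrum_subset_Ioi),
      hG.cfc_rpow_eq hcont (fun t ht => mul_pos hK (Real.rpow_pos_of_pos ht _)), hG.rpow_eq_cfc,
      ← cfc_const_mul _ _ G ((continuousOn_rpow_Ioi q).mono hG.spectrum_subset_Ioi)]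
    refine hG.cfc_congr_of_pos fun t ht => ?_
    rw [Real.rpow_neg_one, mul_inv, Real.rpow_neg ht.le, inv_inv]
  rw [e, CFC.rpow_rpow A q (-1) (by linarith) hA, mul_neg_one] at h3
  have h4 := smul_le_smul_of_nonneg_left h3 hK.le
  rwa [smul_smul, mul_inv_cancel₀ hK.ne', one_smul] at h4

/-! ### The conjugating operator `T = A^{(p-1)/2} k(C)^{(p-1)/2}` -/

section Transform

variable {A C : H →L[ℂ] H} {k : ℝ → ℝ} {p : ℝ}

/-- The operator `A^{(p-1)/2} k(C)^{(p-1)/2}`. -/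
noncomputable def powerTransform (A C : H →L[ℂ] H) (k : ℝ → ℝ) (p : ℝ) : H →L[ℂ] H :=
  A ^ ((p - 1) / 2) * cfc (fun t => k t ^ ((p - 1) / 2)) C

lemma star_powerTransform : star (powerTransform A C k p) =
    cfc (fun t => k t ^ ((p - 1) / 2)) C * A ^ ((p - 1) / 2) := by
  rw [powerTransform, star_mul, star_rpow, IsSelfAdjoint.star_eq (cfc_predicate _ C)]

lemma isUnit_powerTransform (hA : IsStrictlyPositive A) (hC : IsStrictlyPositive C)
    (hk : ContinuousOn k (Set.Ioi 0)) (hk0 : ∀ t, 0 < t → 0 < k t) :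
    IsUnit (powerTransform A C k p) :=
  (hA.isUnit_rpow _).mul (hC.cfc_of_pos (hk.rpow_const_of_pos hk0 _)
    fun t ht => Real.rpow_pos_of_pos (hk0 t ht) _).isUnit

lemma powerTransform_conj_cfc (hC : IsStrictlyPositive C) (hk : ContinuousOn k (Set.Ioi 0))
    (hk0 : ∀ t, 0 < t → 0 < k t) {φ : ℝ → ℝ} (hφ : ContinuousOn φ (Set.Ioi 0)) :
    powerTransform A C k p * cfc φ C * star (powerTransform A C k p) =
      A ^ ((p - 1) / 2) * cfc (fun t => k t ^ (p - 1) * φ t) C * A ^ ((p - 1) / 2) := by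
  have hc := hk.rpow_const_of_pos hk0 ((p - 1) / 2)
  have hc2 : ContinuousOn (fun t => k t ^ ((p - 1) / 2) * φ t) (Set.Ioi 0) := hc.mul hφ
  have e : cfc (fun t => k t ^ ((p - 1) / 2)) C * cfc φ C * cfc (fun t => k t ^ ((p - 1) / 2)) C =
      cfc (fun t => k t ^ (p - 1) * φ t) C := by
    rw [hC.cfc_mul_cfc hc hφ, hC.cfc_mul_cfc hc2 hc]
    refine hC.cfc_congr_of_pos fun t ht => ?_
    rw [mul_right_comm, ← Real.rpow_add (hk0 t ht), add_halves]
  rw [star_powerTransform, powerTransform, ← e]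
  simp only [mul_assoc]

lemma powerTransform_mul_star (hC : IsStrictlyPositive C) (hk : ContinuousOn k (Set.Ioi 0))
    (hk0 : ∀ t, 0 < t → 0 < k t) :
    powerTransform A C k p * star (powerTransform A C k p) =
      A ^ ((p - 1) / 2) * cfc k C ^ (p - 1) * A ^ ((p - 1) / 2) := by
  have h := powerTransform_conj_cfc (A := A) (p := p) hC hk hk0 (φ := fun _ => 1)
    continuousOn_const
  rw [cfc_const_one ℝ C hC.isSelfAdjoint, mul_one] at h
  rw [h, hC.cfc_rpow_eq hk hk0]
  simp only [mul_one]

lemma rpow_conj_rpow_neg_one_rpow (hA : IsStrictlyPositive A) :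
    A ^ ((p - 1) / 2) * (A ^ (-1 : ℝ)) ^ (p - 1) * A ^ ((p - 1) / 2) = 1 := by
  rw [rpow_neg_one_rpow hA]
  exact hA.rpow_conj_rpow_eq_one (by ring)

lemma rpow_half_conj_cfc (hC : IsStrictlyPositive C) (hk : ContinuousOn k (Set.Ioi 0)) :
    C ^ (1 / 2 : ℝ) * cfc k C * C ^ (1 / 2 : ℝ) = cfc (fun t => t * k t) C := by
  have hc2 : ContinuousOn (fun t : ℝ => t ^ (1 / 2 : ℝ) * k t) (Set.Ioi 0) :=
    (continuousOn_rpow_Ioi _).mul hk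
  rw [hC.rpow_eq_cfc, hC.cfc_mul_cfc (continuousOn_rpow_Ioi _) hk,
    hC.cfc_mul_cfc hc2 (continuousOn_rpow_Ioi _)]
  refine hC.cfc_congr_of_pos fun t ht => ?_
  rw [mul_right_comm, ← Real.rpow_add ht]
  norm_num

/-- The right side is the formula of `relativeOperator_rpow` with `A⁻¹` replaced by `k(C)`; all
inner factors then commute and collapse to `k(C)^{p-1} C^p`. -/
lemma powerTransform_conj_rpow (hC : IsStrictlyPositive C)
    (hk : ContinuousOn k (Set.Ioi 0)) (hk0 : ∀ t, 0 < t → 0 < k t) :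
    powerTransform A C k p * C ^ p * star (powerTransform A C k p) =
      A ^ ((p - 1) / 2) * (C ^ (1 / 2 : ℝ) *
        (C ^ (1 / 2 : ℝ) * cfc k C * C ^ (1 / 2 : ℝ)) ^ (p - 1) * C ^ (1 / 2 : ℝ)) *
          A ^ ((p - 1) / 2) := by
  have hc : ContinuousOn (fun t : ℝ => t * k t) (Set.Ioi 0) := continuousOn_id.mul hk
  have hc0 : ∀ t, 0 < t → 0 < t * k t := fun t ht => mul_pos ht (hk0 t ht)
  rw [rpow_half_conj_cfc hC hk, hC.cfc_rpow_eq hc hc0,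
    rpow_half_conj_cfc hC (hc.rpow_const_of_pos hc0 _), hC.rpow_eq_cfc p,
    powerTransform_conj_cfc hC hk hk0 (continuousOn_rpow_Ioi p)]
  congr 2
  refine hC.cfc_congr_of_pos fun t ht => ?_
  rw [Real.mul_rpow ht.le (hk0 t ht).le, Real.rpow_sub_one ht.ne' p]
  field_simp

end Transform

/-! ### Ando–Hiai type bounds -/

section Relative

variable {A B : H →L[ℂ] H} {h k : ℝ → ℝ} {p : ℝ}

/-- The hypothesis `A⁻¹ ≤ k(C)` is used twice through Löwner–Heinz: it bounds the relative operator
of the powers by `T C^p T*` and makes `T` an expansion, as the reverse Hansen inequality requires.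
-/
theorem IsOperatorMonotone.cfc_relativeOperator_rpow_le (hh : IsOperatorMonotone.{u} h)
    (hpos : ∀ t, 0 < t → 0 < h t) (hA : IsStrictlyPositive A) (hB : IsStrictlyPositive B)
    (hp : p ∈ Set.Icc (1 : ℝ) 2) (hk : ContinuousOn k (Set.Ioi 0)) (hk0 : ∀ t, 0 < t → 0 < k t)
    (hle : A ^ (-1 : ℝ) ≤ cfc k (relativeOperator A B)) :
    cfc h (relativeOperator (A ^ p) (B ^ p)) ≤ A ^ ((p - 1) / 2) *
      cfc (fun t => k t ^ (p - 1) * h (t ^ p)) (relativeOperator A B) * A ^ ((p - 1) / 2) := by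
  -- The range `1 ≤ p ≤ 2` is exactly what Löwner–Heinz with exponent `p - 1` demands.
  have hp1 : p - 1 ∈ Set.Icc (0 : ℝ) 1 := ⟨by linarith [hp.1], by linarith [hp.2]⟩
  have hC := isStrictlyPositive_relativeOperator hA hB
  set C := relativeOperator A B with hCdef
  set T := powerTransform A C k p
  have hT : IsUnit T := isUnit_powerTransform hA hC hk hk0
  have h1 : relativeOperator (A ^ p) (B ^ p) ≤ T * C ^ p * star T := by
    rw [relativeOperator_rpow hA hB (by linarith [hp.1]), powerTransform_conj_rpow hC hk hk0]
    exact rpow_conj_mono (rpow_conj_mono (CFC.rpow_le_rpow hp1 (rpow_conj_mono hle _ _)) _ _) _ _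
  have h2 : 1 ≤ T * star T := by
    rw [powerTransform_mul_star hC hk hk0, ← rpow_conj_rpow_neg_one_rpow (p := p) hA]
    exact rpow_conj_mono (CFC.rpow_le_rpow hp1 hle) _ _
  calc cfc h (relativeOperator (A ^ p) (B ^ p)) ≤ cfc h (T * C ^ p * star T) :=
        hh.2 H _ _ (isStrictlyPositive_relativeOperator (hA.rpow_pos p) (hB.rpow_pos p)) h1
    _ ≤ T * cfc h (C ^ p) * star T :=
        hh.cfc_conj_le (fun t ht => (hpos t ht).le) hT h2 (hC.rpow_pos p)
    _ = _ := by
        rw [hC.cfc_comp_rpow hh.1, powerTransform_conj_cfc hC hk hk0 (hh.1.comp_rpow_Ioi p)]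

/-- Mirror image: `k(C) ≤ A⁻¹` makes `T` a contraction, so Hansen's inequality applies directly. -/
theorem IsOperatorMonotone.le_cfc_relativeOperator_rpow (hh : IsOperatorMonotone.{u} h)
    (hpos : ∀ t, 0 < t → 0 < h t) (hA : IsStrictlyPositive A) (hB : IsStrictlyPositive B)
    (hp : p ∈ Set.Icc (1 : ℝ) 2) (hk : ContinuousOn k (Set.Ioi 0)) (hk0 : ∀ t, 0 < t → 0 < k t)
    (hle : cfc k (relativeOperator A B) ≤ A ^ (-1 : ℝ)) :
    A ^ ((p - 1) / 2) * cfc (fun t => k t ^ (p - 1) * h (t ^ p)) (relativeOperator A B) *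
      A ^ ((p - 1) / 2) ≤ cfc h (relativeOperator (A ^ p) (B ^ p)) := by
  have hp1 : p - 1 ∈ Set.Icc (0 : ℝ) 1 := ⟨by linarith [hp.1], by linarith [hp.2]⟩
  have hC := isStrictlyPositive_relativeOperator hA hB
  set C := relativeOperator A B with hCdef
  set T := powerTransform A C k p
  have hT : IsUnit T := isUnit_powerTransform hA hC hk hk0
  have h1 : T * C ^ p * star T ≤ relativeOperator (A ^ p) (B ^ p) := by
    rw [relativeOperator_rpow hA hB (by linarith [hp.1]), powerTransform_conj_rpow hC hk hk0]
    exact rpow_conj_mono (rpow_conj_mono (CFC.rpow_le_rpow hp1 (rpow_conj_mono hle _ _)) _ _) _ _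
  have h2 : T * star T ≤ 1 := by
    rw [powerTransform_mul_star hC hk hk0, ← rpow_conj_rpow_neg_one_rpow (p := p) hA]
    exact rpow_conj_mono (CFC.rpow_le_rpow hp1 hle) _ _
  calc _ = T * cfc h (C ^ p) * star T := by
        rw [hC.cfc_comp_rpow hh.1, powerTransform_conj_cfc hC hk hk0 (hh.1.comp_rpow_Ioi p)]
    _ ≤ cfc h (T * C ^ p * star T) :=
        hh.conj_cfc_le (fun t ht => (hpos t ht).le) hT h2 (hC.rpow_pos p)
    _ ≤ cfc h (relativeOperator (A ^ p) (B ^ p)) :=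
        hh.2 H _ _ (isStrictlyPositive_conj hT (hC.rpow_pos p)) h1

lemma rpow_neg_half_conj_rpow_half_conj (hA : IsStrictlyPositive A) (G : H →L[ℂ] H) :
    A ^ (-(1 / 2) : ℝ) * (A ^ (1 / 2 : ℝ) * G * A ^ (1 / 2 : ℝ)) * A ^ (-(1 / 2) : ℝ) = G := by
  simp only [mul_assoc]
  rw [hA.rpow_mul_rpow_mul, hA.rpow_mul_rpow, neg_add_cancel, add_neg_cancel,
    CFC.rpow_zero A hA.nonneg, one_mul, mul_one]

lemma rpow_neg_half_conj_smul_one (hA : IsStrictlyPositive A) (r : ℝ) :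
    A ^ (-(1 / 2) : ℝ) * (r • 1) * A ^ (-(1 / 2) : ℝ) = r • A ^ (-1 : ℝ) := by
  rw [mul_smul_comm, smul_mul_assoc, mul_one, hA.rpow_mul_rpow]
  norm_num

lemma le_smul_rpow_neg_one_of_conj_le {G : H →L[ℂ] H} {r : ℝ} (hA : IsStrictlyPositive A)
    (hG : A ^ (1 / 2 : ℝ) * G * A ^ (1 / 2 : ℝ) ≤ r • (1 : H →L[ℂ] H)) :
    G ≤ r • A ^ (-1 : ℝ) := by
  have := rpow_conj_mono hG A (-(1 / 2))
  rwa [rpow_neg_half_conj_rpow_half_conj hA, rpow_neg_half_conj_smul_one hA] at this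

lemma smul_rpow_neg_one_le_of_le_conj {G : H →L[ℂ] H} {r : ℝ} (hA : IsStrictlyPositive A)
    (hG : r • (1 : H →L[ℂ] H) ≤ A ^ (1 / 2 : ℝ) * G * A ^ (1 / 2 : ℝ)) :
    r • A ^ (-1 : ℝ) ≤ G := by
  have := rpow_conj_mono hG A (-(1 / 2))
  rwa [rpow_neg_half_conj_rpow_half_conj hA, rpow_neg_half_conj_smul_one hA] at this

lemma rpow_rpow_half_conj (hA : IsStrictlyPositive A) (hp : p ≠ 0) (Z : H →L[ℂ] H) :
    (A ^ p) ^ (1 / 2 : ℝ) * (A ^ ((p - 1) / 2) * Z * A ^ ((p - 1) / 2)) * (A ^ p) ^ (1 / 2 : ℝ) =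
      A ^ ((2 * p - 1) / 2) * Z * A ^ ((2 * p - 1) / 2) := by
  rw [CFC.rpow_rpow A p _ hp hA]
  simp only [mul_assoc]
  rw [hA.rpow_mul_rpow_mul, hA.rpow_mul_rpow]
  ring_nf

/-- Upper Ando–Hiai type bound for a positive operator monotone function. -/
theorem IsOperatorMonotone.conj_cfc_relativeOperator_rpow_le (hh : IsOperatorMonotone.{u} h)
    (hpos : ∀ t, 0 < t → 0 < h t) (hA : IsStrictlyPositive A) (hB : IsStrictlyPositive B)
    (hp : p ∈ Set.Icc (1 : ℝ) 2) {σ c m M : ℝ} (hσ : 0 < σ) (hc : 0 ≤ c)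
    (hm : 0 < m) (hmM : m ≤ M) (hspec : spectrum ℝ A ⊆ Set.Icc m M)
    (hratio : ∀ t ∈ spectrum ℝ (relativeOperator A B), h (t ^ p) ≤ c * h t ^ p)
    (hle : A ^ (1 / 2 : ℝ) * cfc h (relativeOperator A B) * A ^ (1 / 2 : ℝ) ≤ 1)
    (hσle : σ • (1 : H →L[ℂ] H) ≤
      A ^ (1 / 2 : ℝ) * cfc h (relativeOperator A B) * A ^ (1 / 2 : ℝ)) :
    (A ^ p) ^ (1 / 2 : ℝ) * cfc h (relativeOperator (A ^ p) (B ^ p)) * (A ^ p) ^ (1 / 2 : ℝ) ≤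
      (kantorovichConst (M / m) (2 * p - 1) * c * σ ^ (1 - p)) • (1 : H →L[ℂ] H) := by
  have hC := isStrictlyPositive_relativeOperator hA hB
  set C := relativeOperator A B with hCdef
  have hq : 1 ≤ 2 * p - 1 := by linarith [hp.1]
  have hp0 : p ≠ 0 := by linarith [hp.1]
  -- `k = h/σ` turns the lower bound `σ` on the perspective into `A⁻¹ ≤ k(C)`; its power `p - 1`
  -- later produces the factor `σ^{1-p}`.
  have hk : ContinuousOn (fun t => σ⁻¹ * h t) (Set.Ioi 0) := continuousOn_const.mul hh.1
  have hk0 : ∀ t, 0 < t → 0 < σ⁻¹ * h t := fun t ht => mul_pos (inv_pos.2 hσ) (hpos t ht)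
  have hG : cfc h C ≤ A ^ (-1 : ℝ) := by
    rw [← one_smul ℝ (1 : H →L[ℂ] H)] at hle
    simpa using le_smul_rpow_neg_one_of_conj_le hA hle
  have hkC : A ^ (-1 : ℝ) ≤ cfc (fun t => σ⁻¹ * h t) C := by
    rw [cfc_const_mul _ _ C (hh.1.mono hC.spectrum_subset_Ioi)]
    have := smul_le_smul_of_nonneg_left (smul_rpow_neg_one_le_of_le_conj hA hσle)
      (inv_pos.2 hσ).le
    rwa [smul_smul, inv_mul_cancel₀ hσ.ne', one_smul] at this
  have h1 := hh.cfc_relativeOperator_rpow_le hpos hA hB hp hk hk0 hkC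
  have h2 : cfc (fun t => (σ⁻¹ * h t) ^ (p - 1) * h (t ^ p)) C ≤
      (c * σ ^ (1 - p)) • cfc h C ^ (2 * p - 1) := by
    rw [hC.cfc_rpow_eq hh.1 hpos, ← cfc_const_mul _ _ C
      ((hh.1.rpow_const_of_pos hpos _).mono hC.spectrum_subset_Ioi)]
    refine hC.cfc_le_cfc ((hk.rpow_const_of_pos hk0 _).mul (hh.1.comp_rpow_Ioi p))
      (continuousOn_const.mul (hh.1.rpow_const_of_pos hpos _)) fun t ht => ?_
    have hht := hpos t (hC.spectrum_pos ht)
    rw [Real.mul_rpow (inv_pos.2 hσ).le hht.le, Real.inv_rpow hσ.le, ← Real.rpow_neg hσ.le,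
      neg_sub, show 2 * p - 1 = (p - 1) + p by ring, Real.rpow_add hht]
    have hw : 0 ≤ σ ^ (1 - p) * h t ^ (p - 1) := by positivity
    nlinarith [mul_le_mul_of_nonneg_left (hratio t ht) hw]
  have h3 := rpow_le_kantorovichConst_smul_rpow_neg hA (hC.cfc_of_pos hh.1 hpos) hG hm hmM hspec hq
  have hcs : 0 ≤ c * σ ^ (1 - p) := mul_nonneg hc (Real.rpow_nonneg hσ.le _)
  have h4 := h2.trans (smul_le_smul_of_nonneg_left h3 hcs)
  have h5 := rpow_conj_mono (h1.trans (rpow_conj_mono h4 _ _)) (A ^ p) (1 / 2)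
  refine h5.trans_eq ?_
  rw [rpow_rpow_half_conj hA hp0, smul_smul, mul_smul_comm, smul_mul_assoc,
    hA.rpow_conj_rpow_eq_one (by ring)]
  congr 1
  ring

/-- Lower Ando–Hiai type bound for a positive operator monotone function. -/
theorem IsOperatorMonotone.le_conj_cfc_relativeOperator_rpow (hh : IsOperatorMonotone.{u} h)
    (hpos : ∀ t, 0 < t → 0 < h t) (hA : IsStrictlyPositive A) (hB : IsStrictlyPositive B)
    (hp : p ∈ Set.Icc (1 : ℝ) 2) {σ c m M : ℝ} (hσ : 0 < σ) (hc : 0 ≤ c)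
    (hm : 0 < m) (hmM : m ≤ M) (hspec : spectrum ℝ A ⊆ Set.Icc m M)
    (hratio : ∀ t ∈ spectrum ℝ (relativeOperator A B), c * h t ^ p ≤ h (t ^ p))
    (hle : 1 ≤ A ^ (1 / 2 : ℝ) * cfc h (relativeOperator A B) * A ^ (1 / 2 : ℝ))
    (hσle : A ^ (1 / 2 : ℝ) * cfc h (relativeOperator A B) * A ^ (1 / 2 : ℝ) ≤
      σ • (1 : H →L[ℂ] H)) :
    ((kantorovichConst (M / m) (2 * p - 1))⁻¹ * c * σ ^ (1 - p)) • (1 : H →L[ℂ] H) ≤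
      (A ^ p) ^ (1 / 2 : ℝ) * cfc h (relativeOperator (A ^ p) (B ^ p)) * (A ^ p) ^ (1 / 2 : ℝ) := by
  have hC := isStrictlyPositive_relativeOperator hA hB
  set C := relativeOperator A B with hCdef
  have hq : 1 ≤ 2 * p - 1 := by linarith [hp.1]
  have hp0 : p ≠ 0 := by linarith [hp.1]
  have hK : 0 < kantorovichConst (M / m) (2 * p - 1) :=
    one_pos.trans_le (one_le_kantorovichConst ((one_le_div hm).2 hmM) hq)
  have hk : ContinuousOn (fun t => σ⁻¹ * h t) (Set.Ioi 0) := continuousOn_const.mul hh.1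
  have hk0 : ∀ t, 0 < t → 0 < σ⁻¹ * h t := fun t ht => mul_pos (inv_pos.2 hσ) (hpos t ht)
  have hG : A ^ (-1 : ℝ) ≤ cfc h C := by
    rw [← one_smul ℝ (1 : H →L[ℂ] H)] at hle
    simpa using smul_rpow_neg_one_le_of_le_conj hA hle
  have hkC : cfc (fun t => σ⁻¹ * h t) C ≤ A ^ (-1 : ℝ) := by
    rw [cfc_const_mul _ _ C (hh.1.mono hC.spectrum_subset_Ioi)]
    have := smul_le_smul_of_nonneg_left (le_smul_rpow_neg_one_of_conj_le hA hσle)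
      (inv_pos.2 hσ).le
    rwa [smul_smul, inv_mul_cancel₀ hσ.ne', one_smul] at this
  have h1 := hh.le_cfc_relativeOperator_rpow hpos hA hB hp hk hk0 hkC
  have h2 : (c * σ ^ (1 - p)) • cfc h C ^ (2 * p - 1) ≤
      cfc (fun t => (σ⁻¹ * h t) ^ (p - 1) * h (t ^ p)) C := by
    rw [hC.cfc_rpow_eq hh.1 hpos, ← cfc_const_mul _ _ C
      ((hh.1.rpow_const_of_pos hpos _).mono hC.spectrum_subset_Ioi)]
    refine hC.cfc_le_cfc (continuousOn_const.mul (hh.1.rpow_const_of_pos hpos _))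
      ((hk.rpow_const_of_pos hk0 _).mul (hh.1.comp_rpow_Ioi p)) fun t ht => ?_
    have hht := hpos t (hC.spectrum_pos ht)
    rw [Real.mul_rpow (inv_pos.2 hσ).le hht.le, Real.inv_rpow hσ.le, ← Real.rpow_neg hσ.le,
      neg_sub, show 2 * p - 1 = (p - 1) + p by ring, Real.rpow_add hht]
    have hw : 0 ≤ σ ^ (1 - p) * h t ^ (p - 1) := by positivity
    nlinarith [mul_le_mul_of_nonneg_left (hratio t ht) hw]
  have h3 : (kantorovichConst (M / m) (2 * p - 1))⁻¹ • A ^ (-(2 * p - 1)) ≤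
      cfc h C ^ (2 * p - 1) := by
    have := smul_le_smul_of_nonneg_left
      (rpow_neg_le_kantorovichConst_smul_rpow hA hG hm hmM hspec hq) (inv_pos.2 hK).le
    rwa [smul_smul, inv_mul_cancel₀ hK.ne', one_smul] at this
  have hcs : 0 ≤ c * σ ^ (1 - p) := mul_nonneg hc (Real.rpow_nonneg hσ.le _)
  have h4 := (smul_le_smul_of_nonneg_left h3 hcs).trans h2
  have h5 := rpow_conj_mono ((rpow_conj_mono h4 _ _).trans h1) (A ^ p) (1 / 2)
  refine le_of_eq_of_le ?_ h5
  rw [rpow_rpow_half_conj hA hp0, smul_smul, mul_smul_comm, smul_mul_assoc,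
    hA.rpow_conj_rpow_eq_one (by ring)]
  congr 1
  ring

end Relative

end PowerInequalities

/-! ### Constants as spectral quantities -/

section SpectralBounds

variable {H : Type u} [NormedAddCommGroup H] [InnerProductSpace ℂ H] [CompleteSpace H]

lemma lambdaMin_le_of_mem_spectrum {X : H →L[ℂ] H} {x : ℝ} (hx : x ∈ spectrum ℝ X) :
    lambdaMin X ≤ x :=
  csInf_le (spectrum.isCompact X).bddBelow hx

lemma lambdaMin_smul_one_le {X : H →L[ℂ] H} (hX : IsSelfAdjoint X) :
    lambdaMin X • (1 : H →L[ℂ] H) ≤ X :=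
  (smul_one_le_iff_spectrum hX).2 fun _ => lambdaMin_le_of_mem_spectrum

lemma le_norm_smul_one {X : H →L[ℂ] H} (hX : IsSelfAdjoint X) :
    X ≤ ‖X‖ • (1 : H →L[ℂ] H) :=
  hX.le_algebraMap_norm_self.trans_eq (Algebra.algebraMap_eq_smul_one _)

lemma lambdaMin_mem_spectrum [Nontrivial H] {X : H →L[ℂ] H} (hX : IsSelfAdjoint X) :
    lambdaMin X ∈ spectrum ℝ X :=
  (spectrum.isCompact X).sInf_mem
    (ContinuousFunctionalCalculus.spectrum_nonempty X hX)

lemma IsStrictlyPositive.lambdaMin_pos [Nontrivial H] {X : H →L[ℂ] H}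
    (hX : IsStrictlyPositive X) : 0 < lambdaMin X :=
  hX.spectrum_pos (lambdaMin_mem_spectrum hX.isSelfAdjoint)

lemma lambdaMin_le_norm [Nontrivial H] {X : H →L[ℂ] H} (hX : IsSelfAdjoint X) :
    lambdaMin X ≤ ‖X‖ :=
  (le_smul_one_iff_spectrum hX).1 (le_norm_smul_one hX) _ (lambdaMin_mem_spectrum hX)

variable {f : ℝ → ℝ} {p : ℝ} {C : H →L[ℂ] H}

lemma powerRatio_eq_cfc (hf : ContinuousOn f (Set.Ioi 0)) (hpos : ∀ t, 0 < t → 0 < f t)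
    (hC : IsStrictlyPositive C) :
    powerRatio f p C = cfc (fun t => f (t ^ p) * f t ^ (-p)) C := by
  rw [powerRatio, hC.cfc_comp_rpow hf, hC.cfc_rpow_eq hf hpos,
    hC.cfc_mul_cfc (hf.comp_rpow_Ioi p) (hf.rpow_const_of_pos hpos _)]

lemma mem_spectrum_powerRatio (hf : ContinuousOn f (Set.Ioi 0)) (hpos : ∀ t, 0 < t → 0 < f t)
    (hC : IsStrictlyPositive C) {t : ℝ} (ht : t ∈ spectrum ℝ C) :
    f (t ^ p) * f t ^ (-p) ∈ spectrum ℝ (powerRatio f p C) := by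
  have hc : ContinuousOn (fun t => f (t ^ p) * f t ^ (-p)) (Set.Ioi 0) :=
    (hf.comp_rpow_Ioi p).mul (hf.rpow_const_of_pos hpos _)
  rw [powerRatio_eq_cfc hf hpos hC, cfc_map_spectrum _ C hC.isSelfAdjoint
    (hc.mono hC.spectrum_subset_Ioi)]
  exact ⟨t, ht, rfl⟩

lemma isStrictlyPositive_powerRatio (hf : ContinuousOn f (Set.Ioi 0))
    (hpos : ∀ t, 0 < t → 0 < f t) (hC : IsStrictlyPositive C) :
    IsStrictlyPositive (powerRatio f p C) := by
  rw [powerRatio_eq_cfc hf hpos hC]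
  exact hC.cfc_of_pos ((hf.comp_rpow_Ioi p).mul (hf.rpow_const_of_pos hpos _)) fun t ht =>
    mul_pos (hpos _ (Real.rpow_pos_of_pos ht p)) (Real.rpow_pos_of_pos (hpos t ht) _)

/-- By spectral mapping, `f(t^p)/f(t)^p` at a spectral point of `C` is a spectral value of
`powerRatio f p C`, hence at most its norm. -/
lemma apply_rpow_le_norm_powerRatio (hf : ContinuousOn f (Set.Ioi 0))
    (hpos : ∀ t, 0 < t → 0 < f t) (hC : IsStrictlyPositive C) {t : ℝ} (ht : t ∈ spectrum ℝ C) :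
    f (t ^ p) ≤ ‖powerRatio f p C‖ * f t ^ p := by
  have hR := (isStrictlyPositive_powerRatio (p := p) hf hpos hC).isSelfAdjoint
  have h := (le_smul_one_iff_spectrum hR).1 (le_norm_smul_one hR) _
    (mem_spectrum_powerRatio hf hpos hC ht)
  have hft := hpos t (hC.spectrum_pos ht)
  rwa [Real.rpow_neg hft.le, ← div_eq_mul_inv, div_le_iff₀ (Real.rpow_pos_of_pos hft p)] at h

lemma lambdaMin_powerRatio_mul_le (hf : ContinuousOn f (Set.Ioi 0))
    (hpos : ∀ t, 0 < t → 0 < f t) (hC : IsStrictlyPositive C) {t : ℝ} (ht : t ∈ spectrum ℝ C) :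
    lambdaMin (powerRatio f p C) * f t ^ p ≤ f (t ^ p) := by
  have h := lambdaMin_le_of_mem_spectrum (mem_spectrum_powerRatio (p := p) hf hpos hC ht)
  have hft := hpos t (hC.spectrum_pos ht)
  rwa [Real.rpow_neg hft.le, ← div_eq_mul_inv, le_div_iff₀ (Real.rpow_pos_of_pos hft p)] at h

/-- Both Ando–Hiai type bounds, with the spectral quantities as constants. -/
theorem IsOperatorMonotone.andoHiai_bounds [Nontrivial H] {A B P Q R : H →L[ℂ] H} {h : ℝ → ℝ}
    (hh : IsOperatorMonotone.{u} h) (hpos : ∀ t, 0 < t → 0 < h t) (hA : IsStrictlyPositive A)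
    (hB : IsStrictlyPositive B) (hp : p ∈ Set.Icc (1 : ℝ) 2)
    (hP : P = A ^ (1 / 2 : ℝ) * cfc h (relativeOperator A B) * A ^ (1 / 2 : ℝ))
    (hQ : Q = (A ^ p) ^ (1 / 2 : ℝ) * cfc h (relativeOperator (A ^ p) (B ^ p)) *
      (A ^ p) ^ (1 / 2 : ℝ))
    (hR : IsStrictlyPositive R)
    (hRnorm : ∀ t ∈ spectrum ℝ (relativeOperator A B), h (t ^ p) ≤ ‖R‖ * h t ^ p)
    (hRmin : ∀ t ∈ spectrum ℝ (relativeOperator A B), lambdaMin R * h t ^ p ≤ h (t ^ p)) :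
    (P ≤ 1 → Q ≤ (kantorovichConst (conditionNumber A) (2 * p - 1) * ‖R‖ *
      lambdaMin P ^ (1 - p)) • (1 : H →L[ℂ] H)) ∧
    (1 ≤ P → ((kantorovichConst (conditionNumber A) (2 * p - 1))⁻¹ * lambdaMin R *
      ‖P‖ ^ (1 - p)) • (1 : H →L[ℂ] H) ≤ Q) := by
  have hPs : IsStrictlyPositive P := by
    have := isStrictlyPositive_conj (hA.isUnit_rpow (1 / 2))
      ((isStrictlyPositive_relativeOperator hA hB).cfc_of_pos hh.1 hpos)
    rwa [star_rpow, ← hP] at this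
  have hspec := spectrum_subset_Icc hA.isSelfAdjoint (lambdaMin_smul_one_le hA.isSelfAdjoint) le_rfl
  have hmM := lambdaMin_le_norm hA.isSelfAdjoint
  have hPnorm : 0 < ‖P‖ := hPs.lambdaMin_pos.trans_le (lambdaMin_le_norm hPs.isSelfAdjoint)
  have hlow := lambdaMin_smul_one_le hPs.isSelfAdjoint
  have hup := le_norm_smul_one hPs.isSelfAdjoint
  refine ⟨fun hle => ?_, fun hle => ?_⟩
  · have := hh.conj_cfc_relativeOperator_rpow_le hpos hA hB hp hPs.lambdaMin_pos (norm_nonneg R)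
      hA.lambdaMin_pos hmM hspec hRnorm (hP ▸ hle) (by rw [← hP]; exact hlow)
    rwa [← hQ] at this
  · have := hh.le_conj_cfc_relativeOperator_rpow hpos hA hB hp hPnorm hR.lambdaMin_pos.le
      hA.lambdaMin_pos hmM hspec hRmin (hP ▸ hle) (by rw [← hP]; exact hup)
    rwa [← hQ] at this

end SpectralBounds

/-! ### Decreasing functions and the conclusion -/

lemma IsOperatorMonotoneDecreasing.continuousOn {g : ℝ → ℝ}
    (hg : IsOperatorMonotoneDecreasing.{u} g) : ContinuousOn g (Set.Ioi 0) :=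
  hg.1.neg.congr fun x _ => (neg_neg (g x)).symm

/-- If `g` is operator monotone decreasing, then `g(1 / t)` is operator monotone. -/
theorem IsOperatorMonotoneDecreasing.isOperatorMonotone_inv {g : ℝ → ℝ}
    (hg : IsOperatorMonotoneDecreasing.{u} g) : IsOperatorMonotone.{u} (fun t => g t⁻¹) := by
  have hgc := hg.continuousOn
  refine ⟨hgc.comp (continuousOn_id.inv₀ fun x hx => ne_of_gt hx) fun x hx =>
    Set.mem_Ioi.2 (inv_pos.2 hx),
    fun K _ _ _ A B hA hAB => ?_⟩
  have hB := hA.of_le hAB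
  have e : ∀ Z : K →L[ℂ] K, IsStrictlyPositive Z → cfc (fun t => g t⁻¹) Z = cfc g (Z ^ (-1 : ℝ)) :=
    fun Z hZ => by
      rw [hZ.cfc_comp_rpow hgc]
      exact hZ.cfc_congr_of_pos fun x _ => by rw [Real.rpow_neg_one]
  have key := hg.2 K _ _ (hB.rpow_pos (-1)) (CStarAlgebra.rpow_neg_one_le_rpow_neg_one hAB hA)
  rw [cfc_neg, cfc_neg, neg_le_neg_iff] at key
  rwa [e A hA, e B hB]

theorem proposition3p10 {H : Type u} [NormedAddCommGroup H] [InnerProductSpace ℂ H]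
    [CompleteSpace H] (A B : H →L[ℂ] H) (hA : IsStrictlyPositive A) (hB : IsStrictlyPositive B)
    (p : ℝ) (hp : p ∈ Set.Icc (1 : ℝ) 2) :
    (∀ f : ℝ → ℝ, MemOCPlusOne.{u} f → Tendsto f (𝓝[>] 0) (𝓝 0) →
      (operatorPerspective f A B ≤ 1 →
        operatorPerspective f (A ^ p) (B ^ p) ≤
          (kantorovichConst (conditionNumber A) (2 * p - 1) *
            ‖powerRatio f p (relativeOperator A B)‖ *
            lambdaMin (operatorPerspective f A B) ^ (1 - p)) • (1 : H →L[ℂ] H)) ∧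
      (1 ≤ operatorPerspective f A B →
        ((kantorovichConst (conditionNumber A) (2 * p - 1))⁻¹ *
            lambdaMin (powerRatio f p (relativeOperator A B)) *
            ‖operatorPerspective f A B‖ ^ (1 - p)) • (1 : H →L[ℂ] H) ≤
          operatorPerspective f (A ^ p) (B ^ p))) ∧
    (∀ g : ℝ → ℝ, MemOMDPlusOne.{u} g →
      (operatorPerspective g A B ≤ 1 →
        operatorPerspective g (A ^ p) (B ^ p) ≤
          (kantorovichConst (conditionNumber B) (2 * p - 1) *
            ‖powerRatio g p (relativeOperator A B)‖ *
            lambdaMin (operatorPerspective g A B) ^ (1 - p)) • (1 : H →L[ℂ] H)) ∧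
      (1 ≤ operatorPerspective g A B →
        ((kantorovichConst (conditionNumber B) (2 * p - 1))⁻¹ *
            lambdaMin (powerRatio g p (relativeOperator A B)) *
            ‖operatorPerspective g A B‖ ^ (1 - p)) • (1 : H →L[ℂ] H) ≤
          operatorPerspective g (A ^ p) (B ^ p))) := by
  -- On the zero space spectra are empty and `lambdaMin` takes the default value `0`, but all
  -- operators coincide.
  rcases subsingleton_or_nontrivial H with hH | hH
  · have hle : ∀ X Y : H →L[ℂ] H, X ≤ Y := fun X Y => (Subsingleton.elim X Y).le
    exact ⟨fun _ _ _ => ⟨fun _ => hle _ _, fun _ => hle _ _⟩,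
      fun _ _ => ⟨fun _ => hle _ _, fun _ => hle _ _⟩⟩
  have hC := isStrictlyPositive_relativeOperator hA hB
  refine ⟨fun f ⟨hf, hf0, _⟩ hlim => ?_, fun g ⟨hg, hg0, _⟩ => ?_⟩
  -- For `h(t) = f(t)/t` the powers of `t` cancel, so `h(t^p)/h(t)^p = f(t^p)/f(t)^p`.
  · have hdiv : ∀ t : ℝ, 0 < t → (f t / t) ^ p = f t ^ p / t ^ p := fun t ht =>
      Real.div_rpow (hf0 t ht).le ht.le p
    refine (hf.isOperatorMonotone_div hlim).andoHiai_bounds (fun t ht => div_pos (hf0 t ht) ht)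
      hA hB hp (operatorPerspective_eq_relativeOperator hA hB hf.1)
      (operatorPerspective_eq_relativeOperator (hA.rpow_pos p) (hB.rpow_pos p) hf.1)
      (isStrictlyPositive_powerRatio hf.1 hf0 hC) (fun t ht => ?_) (fun t ht => ?_)
    · have ht0 := hC.spectrum_pos ht
      rw [hdiv t ht0, ← mul_div_assoc]
      exact div_le_div_of_nonneg_right (apply_rpow_le_norm_powerRatio hf.1 hf0 hC ht)
        (Real.rpow_nonneg ht0.le p)
    · have ht0 := hC.spectrum_pos ht
      rw [hdiv t ht0, ← mul_div_assoc]
      exact div_le_div_of_nonneg_right (lambdaMin_powerRatio_mul_le hf.1 hf0 hC ht)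
        (Real.rpow_nonneg ht0.le p)
  · have hgc := hg.continuousOn
    -- `A` and `B` are exchanged, hence the condition number of `B`. The constants still refer to `C
    -- = A^{1/2} B⁻¹ A^{1/2}`, whose spectrum consists of the inverses of that of `B^{1/2} A⁻¹
    -- B^{1/2}`.
    refine hg.isOperatorMonotone_inv.andoHiai_bounds (fun t ht => hg0 _ (inv_pos.2 ht))
      hB hA hp (operatorPerspective_eq_relativeOperator_swap hA hB hgc)
      (operatorPerspective_eq_relativeOperator_swap (hA.rpow_pos p) (hB.rpow_pos p) hgc)
      (isStrictlyPositive_powerRatio hgc hg0 hC) (fun t ht => ?_) (fun t ht => ?_)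
    all_goals
      have ht0 := (isStrictlyPositive_relativeOperator hB hA).spectrum_pos ht
      have ht' := inv_mem_spectrum_relativeOperator hA hB ht
      rw [← Real.inv_rpow ht0.le]
    · exact apply_rpow_le_norm_powerRatio hgc hg0 hC ht'
    · exact lambdaMin_powerRatio_mul_le hgc hg0 hC ht'
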